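/- There are a randomized algorithm (a single program for a randomized word RAM) and a constant $k$ such that for every constant $c$ there is a constant $C$ with the following property. Let $G=(V,E)$ be a simple undirected bipartite graph on $n$ vertices with $m$ edges and maximum degree $\Delta$, given by $n$, $m$ and a list of its edges in arbitrary order (neither $\Delta$ nor a bipartition is given). Then, with probability at least $1-n^{-c}$ over the random choices of the algorithm, it halts after at most $C\,(m+1)\,(\lfloor\log_2 n\rfloor+1)^k=\tilde O(m)$ steps and returns a $\Delta$-edge coloring of $G$, that is, a map $\chi:E\to\{1,\dots,\Delta\}$ with $\chi(e)\ne\chi(f)$ for any two distinct edges $e,f$ that share an endpoint. Here a word RAM has a fixed number of registers and a fixed number of zero-initialized arrays of $w$-bit words that are addressed by words; $w$ may be any integer with $w\ge a\,(\lfloor\log_2 n\rfloor+1)$, where $a$ is a constant of the algorithm. One step executes one instruction: an assignment whose right-hand side and array index are expressions built, with a size fixed by the program, from constants, registers and array reads by $+,-,\cdot,\operatorname{div},\bmod,<,=$ on words, or the drawing of a uniformly random number from $\{0,\dots,v\}$ for a computed word $v$, or one test of a branch or loop. -/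

import Mathlib

open scoped ENNReal

/-! A randomized word RAM, programmed in a structured language with a step count, and the
edge-colouring problem as an input/output relation of such machines. -/

namespace WordRAM

/-- Expressions over the registers and the arrays. `monus` is cut-off subtraction, `lt` and `eq`
return `1` for true and `0` for false; `div` and `mod` by zero return `0` and the dividend. -/
inductive Expr where
  /-- A constant. -/
  | lit (k : ℕ)
  /-- The content of a register. -/
  | reg (r : ℕ)
  /-- The content of the cell of array `a` whose index is the value of `i`. -/
  | get (a : ℕ) (i : Expr)
  | add (x y : Expr)
  | monus (x y : Expr)
  | mul (x y : Expr)
  | div (x y : Expr)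
  | mod (x y : Expr)
  | lt (x y : Expr)
  | eq (x y : Expr)

/-- Programs. A program is a finite object, so it mentions only finitely many registers and arrays
and its expressions have bounded size. -/
inductive Prog where
  | skip
  /-- Write the value of `e` into register `r`. -/
  | set (r : ℕ) (e : Expr)
  /-- Write the value of `e` into the cell of array `a` whose index is the value of `i`. -/
  | put (a : ℕ) (i e : Expr)
  /-- Write a fresh uniformly random element of `{0, …, v}` into register `r`, where `v` is the
  value of `e`. -/
  | rand (r : ℕ) (e : Expr)
  | seq (p q : Prog)
  /-- Execute `p` if the value of `e` is nonzero, and `q` otherwise. -/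
  | ite (e : Expr) (p q : Prog)
  /-- Repeat `p` as long as the value of `e` is nonzero. -/
  | loop (e : Expr) (p : Prog)

/-- The memory: registers, and arrays whose cells are addressed by words. -/
structure Memory where
  reg : ℕ → ℕ
  arr : ℕ → ℕ → ℕ

/-- Write `v` into register `r`. -/
def Memory.setReg (s : Memory) (r v : ℕ) : Memory :=
  { s with reg := Function.update s.reg r v }

/-- Write `v` into cell `i` of array `a`. -/
def Memory.setArr (s : Memory) (a i v : ℕ) : Memory :=
  { s with arr := Function.update s.arr a (Function.update (s.arr a) i v) }

/-- The value of an expression on a machine with words of `w` bits: every result that could leave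
the range `{0, …, 2 ^ w - 1}` is reduced modulo `2 ^ w`. -/
def Expr.eval (w : ℕ) (s : Memory) : Expr → ℕ
  | .lit k => k % 2 ^ w
  | .reg r => s.reg r
  | .get a i => s.arr a (i.eval w s)
  | .add x y => (x.eval w s + y.eval w s) % 2 ^ w
  | .monus x y => x.eval w s - y.eval w s
  | .mul x y => (x.eval w s * y.eval w s) % 2 ^ w
  | .div x y => x.eval w s / y.eval w s
  | .mod x y => x.eval w s % y.eval w s
  | .lt x y => if x.eval w s < y.eval w s then 1 % 2 ^ w else 0
  | .eq x y => if x.eval w s = y.eval w s then 1 % 2 ^ w else 0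

/-- A configuration: the stack of the program parts that are still to be executed (the first one
comes next), and the memory. -/
structure Conf where
  todo : List Prog
  mem : Memory

/-- The machine has halted when nothing is left to be executed. -/
def Conf.Halted (c : Conf) : Prop := c.todo = []

/-- One step of the machine, as a probability distribution on the next configuration. A step
executes one instruction, or one test of a branching or a loop, or unfolds one composition.
A halted configuration does not change any more. -/
noncomputable def step (w : ℕ) (c : Conf) : PMF Conf :=
  match c.todo with
  | [] => PMF.pure c
  | .skip :: K => PMF.pure ⟨K, c.mem⟩
  | .set r e :: K => PMF.pure ⟨K, c.mem.setReg r (e.eval w c.mem)⟩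
  | .put a i e :: K => PMF.pure ⟨K, c.mem.setArr a (i.eval w c.mem) (e.eval w c.mem)⟩
  | .rand r e :: K =>
      (PMF.uniformOfFinset (Finset.range (e.eval w c.mem + 1)) Finset.nonempty_range_add_one).map
        fun x => ⟨K, c.mem.setReg r x⟩
  | .seq p q :: K => PMF.pure ⟨p :: q :: K, c.mem⟩
  | .ite e p q :: K => PMF.pure ⟨(if e.eval w c.mem ≠ 0 then p else q) :: K, c.mem⟩
  | .loop e p :: K =>
      PMF.pure ⟨if e.eval w c.mem ≠ 0 then p :: .loop e p :: K else K, c.mem⟩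

/-- The distribution of the configuration that is reached from `c` after exactly `t` steps
(a computation that has halted earlier stays where it is). -/
noncomputable def run (w : ℕ) : ℕ → Conf → PMF Conf
  | 0, c => PMF.pure c
  | t + 1, c => (step w c).bind (run w t)

end WordRAM

/-- A list of the edges of the simple graph `G` on the vertices `0, …, n - 1`: every edge occurs at
exactly one of the `m` positions, with its endpoints in an arbitrary order. In particular, `m` is
the number of edges of `G`. -/
structure EdgeList {n : ℕ} (G : SimpleGraph (Fin n)) (m : ℕ) where
  src : Fin m → Fin n
  tgt : Fin m → Fin n
  adj : ∀ i, G.Adj (src i) (tgt i)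
  bij : Function.Bijective fun i => (⟨s(src i, tgt i), adj i⟩ : G.edgeSet)

namespace EdgeList

variable {n m : ℕ} {G : SimpleGraph (Fin n)}

/-- The edge at position `i`. -/
def edge (L : EdgeList G m) (i : Fin m) : G.edgeSet := ⟨s(L.src i, L.tgt i), L.adj i⟩

/-- The initial memory: `n` and `m` in the registers `0` and `1`, the endpoints of the `i`-th edge
in cell `i` of the arrays `0` and `1`, and zeros everywhere else. Neither the maximum degree nor a
bipartition is supplied. -/
def input (L : EdgeList G m) : WordRAM.Memory where
  reg r := if r = 0 then n else if r = 1 then m else 0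
  arr a i :=
    if h : i < m then
      if a = 0 then (L.src ⟨i, h⟩ : ℕ) else if a = 1 then (L.tgt ⟨i, h⟩ : ℕ) else 0
    else 0

end EdgeList

/-- `χ` is a `κ`-edge coloring of `G`: it assigns to every edge a color from `{1, …, κ}` so that
any two distinct edges with a common endpoint receive distinct colors. -/
def IsEdgeColoring {V : Type*} (G : SimpleGraph V) (κ : ℕ) (χ : G.edgeSet → ℕ) : Prop :=
  (∀ e, 1 ≤ χ e ∧ χ e ≤ κ) ∧ ∀ e f, G.lineGraph.Adj e f → χ e ≠ χ f

/-- Array `2` of the memory holds a `κ`-edge coloring of `G`: its cell `i` is the color of the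
`i`-th edge of the list `L`. -/
def EdgeList.HoldsColoring {n m : ℕ} {G : SimpleGraph (Fin n)} (L : EdgeList G m) (κ : ℕ)
    (s : WordRAM.Memory) : Prop :=
  ∃ χ : G.edgeSet → ℕ, IsEdgeColoring G κ χ ∧ ∀ i : Fin m, s.arr 2 i = χ (L.edge i)

/-! The program that witnesses the theorem is deterministic, so it succeeds with probability one and
`C` does not depend on `c`. It rests on three ideas.

Balanced splitting. Pair up the half-edges of odd weight at each node, leaving at most one unpaired,
and walk along the resulting trails, giving the edges alternating classes. Only the closing point of
a closed trail could spoil the alternation, and in a bipartite multigraph closed trails have even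
length. Hence the two classes differ by at most one at every node (`Traversal.balancedSplit`), in
linear time (`split_spec`).

Matchings by halving weights. Let `D` bound the degrees, let `f` nodes have degree `D`, and let `T ≥
2 * m` be a power of two. Weight `⌊T / D⌋` on every uncoloured edge gives loads at most `T`, and the
`f` full nodes together fall short of `T * f` by less than `T` (`NearPerfect.initial`). Split the
edges of odd weight evenly, round their halves up in one class and down in the other, and choose
which class to round up so that the full nodes keep at least half their weight: `T` is halved and
the property survives (`NearPerfect.halve`). At `T = 1` the loads are at most one and every full
node has load one: the edges of weight one form a matching that covers all nodes of degree `D`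
(`NearPerfect.load_eq_one`).

Levels. The uncoloured edges are kept in `K` classes of maximum degree at most `D`, with `K * D +
used = Δ`. A node is a pair of a vertex and a class, so all classes are treated at once as a single
bipartite multigraph with `m` edges. If `D` is odd, a matching covering the nodes of degree `D` gets
one fresh colour per class and `D` drops by one (`Level.color_matching`). Then `D` is even, and a
balanced split turns `K` classes of degree `D` into `2 * K` of degree `D / 2` (`Level.split`). At `D
= 0` everything is coloured with `Δ` colours. There are `O(log Δ)` levels of cost `O((m + 1) log (m
+ 2))` each (`edgeColoring_spec`). -/

namespace WordRAM

/-! ### Big-step semantics of deterministic programs -/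

/-- `Exec w p s t s'`: started in the memory `s`, the program `p` draws no random number and
ends after exactly `t` steps in the memory `s'`. -/
inductive Exec (w : ℕ) : Prog → Memory → ℕ → Memory → Prop
  | skip (s) : Exec w .skip s 1 s
  | set (r e s) : Exec w (.set r e) s 1 (s.setReg r (e.eval w s))
  | put (a i e s) : Exec w (.put a i e) s 1 (s.setArr a (i.eval w s) (e.eval w s))
  | seq {p q s s' s'' t t'} : Exec w p s t s' → Exec w q s' t' s'' →
      Exec w (.seq p q) s (t + t' + 1) s''
  | ite_true {e p q s s' t} : e.eval w s ≠ 0 → Exec w p s t s' →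
      Exec w (.ite e p q) s (t + 1) s'
  | ite_false {e p q s s' t} : e.eval w s = 0 → Exec w q s t s' →
      Exec w (.ite e p q) s (t + 1) s'
  | loop_done {e p s} : e.eval w s = 0 → Exec w (.loop e p) s 1 s
  | loop_step {e p s s' s'' t t'} : e.eval w s ≠ 0 → Exec w p s t s' →
      Exec w (.loop e p) s' t' s'' → Exec w (.loop e p) s (t + t' + 1) s''

/-- Every step is a point mass, so the binds collapse. The arbitrary stack `K` and remaining time
`T` let the induction pass through compositions and loops. -/
theorem Exec.run_eq {w p s t s'} (h : Exec w p s t s') :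
    ∀ K T, run w (t + T) ⟨p :: K, s⟩ = run w T ⟨K, s'⟩ := by
  induction h with
  | skip | set | put =>
    intro K T
    rw [Nat.add_comm 1 T]
    simp [run, step]
  | @seq p q s s' s'' t t' h1 h2 ih1 ih2 =>
    intro K T
    rw [show t + t' + 1 + T = (t + (t' + T)) + 1 by omega]
    simp [run, step, ih1, ih2]
  | @ite_true e p q s s' t he h1 ih =>
    intro K T
    rw [show t + 1 + T = (t + T) + 1 by omega]
    simp [run, step, ih, he]
  | @ite_false e p q s s' t he h1 ih =>
    intro K T
    rw [show t + 1 + T = (t + T) + 1 by omega]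
    simp [run, step, ih, he]
  | @loop_done e p s he =>
    intro K T
    rw [Nat.add_comm 1 T]
    simp [run, step, he]
  | @loop_step e p s s' s'' t t' he h1 h2 ih1 ih2 =>
    intro K T
    rw [show t + t' + 1 + T = (t + (t' + T)) + 1 by omega]
    simp [run, step, ih1, ih2, he]

theorem run_nil (w T : ℕ) (s : Memory) : run w T ⟨[], s⟩ = PMF.pure ⟨[], s⟩ := by
  induction T with
  | zero => rfl
  | succ T ih => simp [run, step, ih]

/-- The registers a program may write to. -/
def Prog.regs : Prog → List ℕ
  | .skip => []
  | .set r _ => [r]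
  | .put _ _ _ => []
  | .rand r _ => [r]
  | .seq p q => p.regs ++ q.regs
  | .ite _ p q => p.regs ++ q.regs
  | .loop _ p => p.regs

/-- The arrays a program may write to. -/
def Prog.arrs : Prog → List ℕ
  | .skip => []
  | .set _ _ => []
  | .put a _ _ => [a]
  | .rand _ _ => []
  | .seq p q => p.arrs ++ q.arrs
  | .ite _ p q => p.arrs ++ q.arrs
  | .loop _ p => p.arrs

@[simp] theorem Memory.reg_setReg (s : Memory) (r v q : ℕ) :
    (s.setReg r v).reg q = if q = r then v else s.reg q := by
  simp [Memory.setReg, Function.update_apply]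

@[simp] theorem Memory.arr_setReg (s : Memory) (r v : ℕ) : (s.setReg r v).arr = s.arr := rfl

@[simp] theorem Memory.reg_setArr (s : Memory) (a i v : ℕ) : (s.setArr a i v).reg = s.reg := rfl

@[simp] theorem Memory.arr_setArr (s : Memory) (a i v b : ℕ) :
    (s.setArr a i v).arr b = if b = a then Function.update (s.arr a) i v else s.arr b := by
  by_cases h : b = a <;> simp [Memory.setArr, h]

theorem Exec.reg_eq {w p s t s'} (h : Exec w p s t s') {r : ℕ} (hr : r ∉ p.regs) :
    s'.reg r = s.reg r := by
  induction h <;> simp_all [Prog.regs]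

theorem Exec.arr_eq {w p s t s'} (h : Exec w p s t s') {a : ℕ} (ha : a ∉ p.arrs) :
    s'.arr a = s.arr a := by
  induction h <;> simp_all [Prog.arrs]

/-! ### Total correctness with step bounds -/

/-- Started in `s`, the program `p` ends within `B` steps in a memory that satisfies `Q`. -/
def WP (w : ℕ) (p : Prog) (B : ℕ) (Q : Memory → Prop) (s : Memory) : Prop :=
  ∃ t s', Exec w p s t s' ∧ t ≤ B ∧ Q s'

/-- `s'` differs from `s` at most in what `p` may write. -/
def Frame (p : Prog) (s s' : Memory) : Prop :=
  (∀ r, r ∉ p.regs → s'.reg r = s.reg r) ∧ ∀ a, a ∉ p.arrs → s'.arr a = s.arr a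

theorem Frame.refl (p : Prog) (s : Memory) : Frame p s s := ⟨fun _ _ => rfl, fun _ _ => rfl⟩

theorem Frame.trans {p s s' s''} (h : Frame p s s') (h' : Frame p s' s'') : Frame p s s'' :=
  ⟨fun r hr => (h'.1 r hr).trans (h.1 r hr), fun a ha => (h'.2 a ha).trans (h.2 a ha)⟩

/-- The new postcondition may use the frame of the executed program, so specifications need not list
what stays unchanged. -/
theorem WP.mono {w p B B' Q Q' s} (h : WP w p B Q s) (hB : B ≤ B')
    (hQ : ∀ s', Frame p s s' → Q s' → Q' s') : WP w p B' Q' s := by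
  obtain ⟨t, s', h1, h2, h3⟩ := h
  exact ⟨t, s', h1, h2.trans hB, hQ s' ⟨fun _ => h1.reg_eq, fun _ => h1.arr_eq⟩ h3⟩

theorem WP.set {w r e Q s} (h : Q (s.setReg r (e.eval w s))) : WP w (.set r e) 1 Q s :=
  ⟨_, _, .set r e s, le_rfl, h⟩

theorem WP.seq {w p q B B' Q s} (h : WP w p B (fun s' => Frame p s s' → WP w q B' Q s') s) :
    WP w (.seq p q) (B + B' + 1) Q s := by
  obtain ⟨t, s', h1, h2, h3⟩ := h
  obtain ⟨t', s'', h4, h5, h6⟩ := h3 ⟨fun _ => h1.reg_eq, fun _ => h1.arr_eq⟩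
  exact ⟨_, _, .seq h1 h4, by omega, h6⟩

theorem WP.ite {w e p q B Q s} (hp : e.eval w s ≠ 0 → WP w p B Q s)
    (hq : e.eval w s = 0 → WP w q B Q s) : WP w (.ite e p q) (B + 1) Q s := by
  by_cases he : e.eval w s = 0
  · obtain ⟨t, s', h1, h2, h3⟩ := hq he
    exact ⟨_, _, .ite_false he h1, by omega, h3⟩
  · obtain ⟨t, s', h1, h2, h3⟩ := hp he
    exact ⟨_, _, .ite_true he h1, by omega, h3⟩

/-- Each iteration costs its body and one test and lowers `μ`; the final `1` pays for the failing
test. -/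
theorem WP.loop {w e p B} (I : Memory → Prop) (μ : Memory → ℕ)
    (hstep : ∀ s, I s → e.eval w s ≠ 0 → WP w p B (fun s' => I s' ∧ μ s' < μ s) s) :
    ∀ {s}, I s → WP w (.loop e p) ((B + 1) * μ s + 1) (fun s' => I s' ∧ e.eval w s' = 0) s := by
  intro s
  induction hn : μ s using Nat.strong_induction_on generalizing s with
  | _ k ih =>
    intro hI
    by_cases he : e.eval w s = 0
    · exact ⟨_, _, .loop_done he, by omega, hI, he⟩
    · obtain ⟨t, s', h1, h2, h3, h4⟩ := hstep s hI he
      obtain ⟨t', s'', h5, h6, h7⟩ := ih _ (hn ▸ h4) rfl h3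
      refine ⟨_, _, .loop_step he h1 h5, ?_, h7⟩
      have : (B + 1) * (μ s' + 1) ≤ (B + 1) * k := Nat.mul_le_mul_left _ (by omega)
      rw [Nat.mul_add] at this
      omega

theorem WP.loop_frame {w e p B s} (I : Memory → Prop) (μ : Memory → ℕ)
    (hstep : ∀ s', Frame p s s' → I s' → e.eval w s' ≠ 0 →
      WP w p B (fun s'' => I s'' ∧ μ s'' < μ s') s') (hI : I s) :
    WP w (.loop e p) ((B + 1) * μ s + 1) (fun s' => I s' ∧ e.eval w s' = 0) s := by
  refine (WP.loop (fun s' => Frame p s s' ∧ I s') μ ?_ ⟨Frame.refl p s, hI⟩).mono le_rfl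
    fun s' _ h => ⟨h.1.2, h.2⟩
  rintro s' ⟨hF, hI'⟩ he
  exact (hstep s' hF hI' he).mono le_rfl fun s'' hF' h => ⟨⟨hF.trans hF', h.1⟩, h.2⟩

/-! ### Loop-free programs -/

/-- The program contains neither loops nor random choices. -/
def Prog.loopFree : Prog → Bool
  | .skip | .set _ _ | .put _ _ _ => true
  | .rand _ _ | .loop _ _ => false
  | .seq p q | .ite _ p q => p.loopFree && q.loopFree

/-- The effect of a loop-free program. -/
def Prog.exec (w : ℕ) : Prog → Memory → Memory
  | .skip, s | .rand _ _, s | .loop _ _, s => s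
  | .set r e, s => s.setReg r (e.eval w s)
  | .put a i e, s => s.setArr a (i.eval w s) (e.eval w s)
  | .seq p q, s => q.exec w (p.exec w s)
  | .ite e p q, s => if e.eval w s ≠ 0 then p.exec w s else q.exec w s

/-- The maximal number of steps of a loop-free program. -/
def Prog.cost : Prog → ℕ
  | .skip | .set _ _ | .put _ _ _ | .rand _ _ | .loop _ _ => 1
  | .seq p q => p.cost + q.cost + 1
  | .ite _ p q => max p.cost q.cost + 1

theorem WP.of_loopFree {w p} (hp : p.loopFree = true) {Q s} (hQ : Q (p.exec w s)) :
    WP w p p.cost Q s := by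
  induction p generalizing s Q with
  | skip => exact ⟨_, _, .skip s, le_rfl, hQ⟩
  | set r e => exact ⟨_, _, .set r e s, le_rfl, hQ⟩
  | put a i e => exact ⟨_, _, .put a i e s, le_rfl, hQ⟩
  | rand | loop => simp [Prog.loopFree] at hp
  | seq p q ihp ihq =>
    simp only [Prog.loopFree, Bool.and_eq_true] at hp
    exact WP.seq (ihp hp.1 fun _ => ihq hp.2 hQ)
  | ite e p q ihp ihq =>
    simp only [Prog.loopFree, Bool.and_eq_true] at hp
    refine WP.ite (fun he => ?_) (fun he => ?_)
    · refine (ihp (Q := Q) hp.1 ?_).mono (le_max_left _ _) fun _ _ h => h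
      simpa [Prog.exec, he] using hQ
    · refine (ihq (Q := Q) hp.2 ?_).mono (le_max_right _ _) fun _ _ h => h
      simpa [Prog.exec, he] using hQ

/-- Execute `p` with the register `i` running from `0` to the content of register `b`, exclusive. -/
def Prog.forUpTo (i b : ℕ) (p : Prog) : Prog :=
  .seq (.set i (.lit 0)) (.loop (.lt (.reg i) (.reg b)) (.seq p (.set i (.add (.reg i) (.lit 1)))))

/-- For a loop-free body the invariant step concerns the explicit memory `p.exec w s'`, which `simp`
can compute. An iteration costs the body plus three: composition, increment and test. The bound `N <
2 ^ w` keeps the counter from wrapping around. -/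
theorem WP.forUpTo {w i b p N s Q} (Inv : ℕ → Memory → Prop) (hN : s.reg b = N)
    (hNw : N < 2 ^ w)
    (h0 : Inv 0 (s.setReg i 0))
    (hstep : ∀ j < N, ∀ s', Inv j s' → s'.reg i = j → s'.reg b = N →
      Frame (.forUpTo i b p) s s' → Inv (j + 1) ((p.exec w s').setReg i (j + 1)))
    (hQ : ∀ s', Inv N s' → Frame (.forUpTo i b p) s s' → Q s')
    (hp : p.loopFree = true := by decide) (hi : i ∉ p.regs := by decide)
    (hb : b ∉ p.regs := by decide) (hib : b ≠ i := by decide) :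
    WP w (.forUpTo i b p) ((p.cost + 3) * N + 3) Q s := by
  refine (WP.seq (B := 1) (B' := (p.cost + 1 + 1 + 1) * N + 1) (WP.set fun _ => ?_)).mono
    (by ring_nf; omega) fun s' hF h => hQ s' h hF
  have key : ∀ s', (s'.reg i ≤ N ∧ s'.reg b = N ∧ Inv (s'.reg i) s' ∧
      Frame (.forUpTo i b p) s s') → ((Expr.lt (.reg i) (.reg b)).eval w s' ≠ 0) →
      WP w (.seq p (.set i (.add (.reg i) (.lit 1)))) (p.cost + 1 + 1)
      (fun s'' => (s''.reg i ≤ N ∧ s''.reg b = N ∧ Inv (s''.reg i) s'' ∧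
        Frame (.forUpTo i b p) s s'') ∧ N - s''.reg i < N - s'.reg i) s' := by
    rintro s' ⟨h1, h2, h3, h4⟩ he
    have hlt : s'.reg i < N := by
      by_contra hc
      simp [Expr.eval, h2, hc] at he
    refine WP.seq (WP.of_loopFree hp fun hF => WP.set ?_)
    have e1 : (p.exec w s').reg i = s'.reg i := hF.1 i hi
    have e2 : (p.exec w s').reg b = s'.reg b := hF.1 b hb
    have e3 : (Expr.add (.reg i) (.lit 1)).eval w (p.exec w s') = s'.reg i + 1 := by
      simp only [Expr.eval, e1, Nat.add_mod_mod]
      exact Nat.mod_eq_of_lt (by omega)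
    rw [e3]
    refine ⟨⟨?_, ?_, ?_, ?_⟩, ?_⟩
    · simp; omega
    · simp [hib, e2, h2]
    · simpa using hstep _ hlt s' h3 rfl h2 h4
    · constructor
      · intro r hr
        have hr' := hr
        simp [Prog.forUpTo, Prog.regs] at hr'
        simp [hr'.1, hF.1 r hr'.2.1, h4.1 r hr]
      · intro a ha
        have ha' := ha
        simp [Prog.forUpTo, Prog.arrs] at ha'
        simp [hF.2 a ha', h4.2 a ha]
    · simp; omega
  have := WP.loop _ (fun s' => N - s'.reg i) key (s := s.setReg i ((Expr.lit 0).eval w s))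
    ⟨by simp [Expr.eval], by simp [hib, hN], by simpa [Expr.eval] using h0, by
      constructor
      · intro r hr
        simp [Prog.forUpTo, Prog.regs] at hr
        simp [hr]
      · intro a _
        rfl⟩
  refine this.mono (by simp [Expr.eval]) ?_
  rintro s' - ⟨⟨h1, h2, h3, h4⟩, he⟩
  have : s'.reg i = N := by
    by_contra hc
    have hlt : s'.reg i < N := by omega
    have h1w : 1 < 2 ^ w := by omega
    simp [Expr.eval, h2, hlt, Nat.mod_eq_of_lt h1w] at he
  rwa [this] at h3

/-! ### Balanced splitting of a bipartite multigraph

The half-edges of the edge `e` are `2 * e` and `2 * e + 1`; `nd h` is the node of the half-edge `h`,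
and `wt e` the weight of the edge `e`. -/

/-- `mate` pairs up half-edges of odd weight that lie at the same node; `mate h = g + 1` means that
`h` is paired with `g`, and `mate h = 0` that `h` is unpaired. At every node, at most one half-edge
of odd weight is unpaired. -/
structure Mating (M : ℕ) (nd wt mate : ℕ → ℕ) : Prop where
  symm : ∀ h < M, ∀ g, mate h = g + 1 →
    g < M ∧ mate g = h + 1 ∧ nd g = nd h ∧ g ≠ h ∧ wt (h / 2) % 2 = 1 ∧ wt (g / 2) % 2 = 1
  uniq : ∀ h < M, ∀ g < M, wt (h / 2) % 2 = 1 → wt (g / 2) % 2 = 1 → mate h = 0 → mate g = 0 →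
    nd h = nd g → h = g

/-- The half-edges below `j` have been paired up, and `pend` holds the ones that are unpaired. -/
structure PartialMating (M : ℕ) (nd wt : ℕ → ℕ) (j : ℕ) (mate pend : ℕ → ℕ) : Prop where
  symm : ∀ h < M, ∀ g, mate h = g + 1 → h < j ∧ g < j ∧ mate g = h + 1 ∧ nd g = nd h ∧ g ≠ h ∧
    wt (h / 2) % 2 = 1 ∧ wt (g / 2) % 2 = 1
  unpaired : ∀ h < j, wt (h / 2) % 2 = 1 → mate h = 0 → pend (nd h) = h + 1
  pending : ∀ h < M, ∀ p, pend (nd h) = p + 1 →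
    p < j ∧ wt (p / 2) % 2 = 1 ∧ nd p = nd h ∧ mate p = 0

theorem PartialMating.zero {M nd wt mate pend} (h1 : ∀ h < M, mate h = 0)
    (h2 : ∀ h < M, pend (nd h) = 0) : PartialMating M nd wt 0 mate pend where
  symm h hh g hg := by simp [h1 h hh] at hg
  unpaired h hh := by omega
  pending h hh p hp := by simp [h2 h hh] at hp

/-- `pend` has one cell per node, so two unpaired half-edges of odd weight at one node would have to
share it. -/
theorem PartialMating.mating {M nd wt mate pend} (H : PartialMating M nd wt M mate pend) :
    Mating M nd wt mate where
  symm h hh g hg := (H.symm h hh g hg).2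
  uniq h hh g hg oh og mh mg e := by
    have h1 := H.unpaired h hh oh mh
    have h2 := H.unpaired g hg og mg
    rw [e] at h1
    omega

theorem PartialMating.succ_even {M nd wt j mate pend} (H : PartialMating M nd wt j mate pend)
    (hj : wt (j / 2) % 2 = 0) : PartialMating M nd wt (j + 1) mate pend where
  symm h hh g hg := by have := H.symm h hh g hg; grind
  unpaired h hh o hm := by
    have := H.unpaired h
    grind
  pending h hh p hp := by have := H.pending h hh p hp; grind

theorem PartialMating.succ_pend {M nd wt j mate pend} (H : PartialMating M nd wt j mate pend)
    (hjM : j < M) (hj : wt (j / 2) % 2 ≠ 0) (hp : pend (nd j) = 0) :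
    PartialMating M nd wt (j + 1) mate (Function.update pend (nd j) (j + 1)) where
  symm h hh g hg := by have := H.symm h hh g hg; grind
  unpaired h hh o hm := by
    have := H.unpaired h
    by_cases hn : nd h = nd j
    · rw [hn, Function.update_self]
      by_cases hhj : h = j
      · omega
      · have := this (by omega) o hm
        rw [hn] at this
        omega
    · rw [Function.update_of_ne hn]
      exact this (by grind) o hm
  pending h hh p hp' := by
    by_cases hn : nd h = nd j
    · rw [hn, Function.update_self] at hp'
      have : p = j := by omega
      subst this
      refine ⟨by omega, by omega, hn.symm, ?_⟩
      rcases hm : mate p with - | g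
      · rfl
      · have := (H.symm p hjM g hm).1
        omega
    · rw [Function.update_of_ne hn] at hp'
      have := H.pending h hh p hp'
      grind

theorem PartialMating.succ_pair {M nd wt j mate pend p} (H : PartialMating M nd wt j mate pend)
    (hjM : j < M) (hj : wt (j / 2) % 2 ≠ 0) (hp : pend (nd j) = p + 1) :
    PartialMating M nd wt (j + 1) (Function.update (Function.update mate j (p + 1)) p (j + 1))
      (Function.update pend (nd j) 0) := by
  obtain ⟨hpj, hpo, hpn, hpm⟩ := H.pending j hjM p hp
  have hj0 : mate j = 0 := by
    rcases hm : mate j with - | g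
    · rfl
    · have := (H.symm j hjM g hm).1
      omega
  constructor
  · intro h hh g hg
    by_cases h1 : h = p
    · subst h1
      rw [Function.update_self] at hg
      have : g = j := by omega
      subst this
      rw [Function.update_of_ne (by omega), Function.update_self]
      exact ⟨by omega, by omega, rfl, hpn.symm, by omega, hpo, by omega⟩
    · rw [Function.update_of_ne h1] at hg
      by_cases h2 : h = j
      · subst h2
        rw [Function.update_self] at hg
        have : g = p := by omega
        subst this
        rw [Function.update_self]
        exact ⟨by omega, by omega, rfl, hpn, by omega, by omega, hpo⟩
      · rw [Function.update_of_ne h2] at hg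
        obtain ⟨a1, a2, a3, a4, a5, a6, a7⟩ := H.symm h hh g hg
        have h3 : g ≠ p := by rintro rfl; omega
        rw [Function.update_of_ne h3, Function.update_of_ne (by omega)]
        exact ⟨by omega, by omega, a3, a4, a5, a6, a7⟩
  · intro h hh o hm
    by_cases h1 : h = p
    · subst h1; rw [Function.update_self] at hm; omega
    · rw [Function.update_of_ne h1] at hm
      by_cases h2 : h = j
      · subst h2; rw [Function.update_self] at hm; omega
      · rw [Function.update_of_ne h2] at hm
        have := H.unpaired h (by omega) o hm
        rw [Function.update_of_ne, this]
        intro hn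
        rw [hn] at this
        omega
  · intro h hh q hq
    by_cases hn : nd h = nd j
    · rw [hn, Function.update_self] at hq; omega
    · rw [Function.update_of_ne hn] at hq
      obtain ⟨a1, a2, a3, a4⟩ := H.pending h hh q hq
      refine ⟨by omega, a2, a3, ?_⟩
      rw [Function.update_of_ne, Function.update_of_ne (by omega), a4]
      rintro rfl
      exact hn (a3.symm.trans hpn)

/-! ### Alternating trails and the parity of closed trails -/

/-- `β` is a two-colouring of the nodes, read off at the half-edges. -/
structure HalfEdgeColoring (m : ℕ) (nd : ℕ → ℕ) (β : ℕ → Bool) : Prop where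
  eq_of_nd : ∀ h < 2 * m, ∀ g < 2 * m, nd h = nd g → β h = β g
  ne : ∀ h < 2 * m, ∀ g < 2 * m, h / 2 = g / 2 → h ≠ g → β h ≠ β g

/-- The state of the traversal that assigns the bits `1` and `2` to the edges of odd weight. The next
edge to start from is `e`, the current half-edge is `cur - 1`, and the trail has to be continued later
at the half-edge `alt - 1`. -/
structure Traversal (m : ℕ) (wt mate : ℕ → ℕ) (β : ℕ → Bool) (e cur alt : ℕ) (bit : ℕ → ℕ) :
    Prop where
  le : e ≤ m
  bit_le : ∀ i < m, bit i ≤ 2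
  started : ∀ i < e, wt i % 2 = 1 → bit i ≠ 0
  cur_le : cur ≤ 2 * m
  alt_le : alt ≤ 2 * m
  cur_bit : cur ≠ 0 → bit ((cur - 1) / 2) ≠ 0
  alt_bit : alt ≠ 0 → bit ((alt - 1) / 2) ≠ 0
  alt_eq : cur = 0 → alt = 0
  closed : ∀ x < 2 * m, bit (x / 2) ≠ 0 → x + 1 = cur ∨ x + 1 = alt ∨ mate x = 0 ∨
    (bit ((mate x - 1) / 2) ≠ 0 ∧ bit ((mate x - 1) / 2) ≠ bit (x / 2))
  out : alt ≠ 0 → ((bit ((cur - 1) / 2) = 1 ↔ β (cur - 1) = true) ↔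
    ¬ (bit ((alt - 1) / 2) = 1 ↔ β (alt - 1) = true))

theorem Traversal.zero {m wt mate β bit} (h : ∀ i < m, bit i = 0) :
    Traversal m wt mate β 0 0 0 bit where
  le := Nat.zero_le _
  bit_le i hi := by simp [h i hi]
  started i hi := by omega
  cur_le := Nat.zero_le _
  alt_le := Nat.zero_le _
  cur_bit h := absurd rfl h
  alt_bit h := absurd rfl h
  alt_eq _ := rfl
  closed x hx hb := absurd (h _ (by omega)) hb
  out h := absurd rfl h

/-- The trail is stuck at its current end and resumes at the other one. The abandoned end needs an
argument only if its mate lies on an edge that already has a bit. -/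
theorem Traversal.retreat {m nd wt mate β e cur alt bit} (H : Traversal m wt mate β e cur alt bit)
    (hM : Mating (2 * m) nd wt mate) (hβ : HalfEdgeColoring m nd β)
    (hg : mate (cur - 1) = 0 ∨ bit ((mate (cur - 1) - 1) / 2) ≠ 0) :
    Traversal m wt mate β e alt 0 bit where
  le := H.le
  bit_le := H.bit_le
  started := H.started
  cur_le := H.alt_le
  alt_le := by omega
  cur_bit := H.alt_bit
  alt_bit h := by omega
  alt_eq _ := rfl
  out h := by omega
  closed x hx hb := by
    rcases H.closed x hx hb with h | h | h | h
    · right; right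
      by_cases hm : mate x = 0
      · exact .inl hm
      · right
        obtain rfl : x = cur - 1 := by omega
        obtain ⟨g, hg'⟩ := Nat.exists_eq_succ_of_ne_zero hm
        obtain ⟨g1, g2, g3, g4, g5, g6⟩ := hM.symm _ hx g hg'
        simp only [hg', Nat.succ_eq_add_one, Nat.add_sub_cancel] at hg ⊢
        have hg0 : bit (g / 2) ≠ 0 := by omega
        refine ⟨hg0, ?_⟩
        rcases H.closed g g1 hg0 with k | k | k | k
        · omega
        -- The trail closes up: both ends lie at one node, so `β` agrees there and `out` forces
        -- different bits. This is where bipartiteness enters.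
        · have := H.out (by omega)
          have hb' := hβ.eq_of_nd _ g1 _ hx g3
          rw [← k, Nat.add_sub_cancel, hb'] at this
          intro heq
          rw [heq] at this
          tauto
        · omega
        · rw [g2, Nat.add_sub_cancel] at k
          exact k.2.symm
    · exact .inl h
    · exact .inr (.inr (.inl h))
    · exact .inr (.inr (.inr h))

/-- The successor of the other half-edge of the same edge as the half-edge `g - 1`. -/
def opp (g : ℕ) : ℕ := g + 2 * (g % 2) - 1

/-- Crossing an edge flips the side, and alternation flips the bit (`3 - b` exchanges `1` and `2`).
Whether bit `1` agrees with `β` is therefore unchanged at the moving end, which preserves `out`. -/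
theorem Traversal.advance {m nd wt mate β e cur alt bit} (H : Traversal m wt mate β e cur alt bit)
    (hM : Mating (2 * m) nd wt mate) (hβ : HalfEdgeColoring m nd β) (hc : cur ≠ 0)
    (hg : mate (cur - 1) ≠ 0) (hb : bit ((mate (cur - 1) - 1) / 2) = 0) :
    Traversal m wt mate β e (opp (mate (cur - 1))) alt
      (Function.update bit ((mate (cur - 1) - 1) / 2) (3 - bit ((cur - 1) / 2))) := by
  obtain ⟨c, rfl⟩ := Nat.exists_eq_succ_of_ne_zero hc
  simp only [Nat.succ_eq_add_one, Nat.add_sub_cancel] at *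
  obtain ⟨g, hg'⟩ := Nat.exists_eq_succ_of_ne_zero hg
  have hcl := H.cur_le
  obtain ⟨g1, g2, g3, g4, g5, g6⟩ := hM.symm c (by omega) g hg'
  rw [hg'] at hb ⊢
  simp only [Nat.succ_eq_add_one, Nat.add_sub_cancel] at *
  have hcb : bit (c / 2) ≠ 0 := by simpa using H.cur_bit
  have hcb2 : bit (c / 2) ≤ 2 := H.bit_le _ (by omega)
  have hcg : c / 2 ≠ g / 2 := by intro h; rw [h] at hcb; omega
  obtain ⟨o, ho, ho2, hog⟩ : ∃ o, opp (g + 1) = o + 1 ∧ o / 2 = g / 2 ∧ o ≠ g := by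
    rcases Nat.even_or_odd' g with ⟨q, rfl | rfl⟩
    · exact ⟨2 * q + 1, by unfold opp; omega, by omega, by omega⟩
    · exact ⟨2 * q, by unfold opp; omega, by omega, by omega⟩
  rw [ho]
  have hupd : ∀ i, bit i ≠ 0 →
      Function.update bit (g / 2) (3 - bit (c / 2)) i = bit i := by
    intro i hi
    apply Function.update_of_ne
    rintro rfl
    exact hi hb
  have hle := H.alt_le
  constructor
  · exact H.le
  · intro i hi
    have := H.bit_le i hi
    rw [Function.update_apply]
    split_ifs <;> omega
  · intro i hi hw
    rw [hupd _ (H.started i hi hw)]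
    exact H.started i hi hw
  · omega
  · exact H.alt_le
  · intro _
    rw [Nat.add_sub_cancel, ho2, Function.update_self]
    omega
  · intro h
    rw [hupd _ (H.alt_bit h)]
    exact H.alt_bit h
  · omega
  · intro x hx hx0
    by_cases hxg : x / 2 = g / 2
    · by_cases hxg' : x = g
      · subst hxg'
        right; right; right
        rw [g2, Nat.add_sub_cancel, hupd _ hcb, Function.update_self]
        omega
      · left; omega
    · rw [Function.update_of_ne hxg] at hx0 ⊢
      rcases H.closed x hx hx0 with k | k | k | k
      · obtain rfl : x = c := by omega
        right; right; right
        rw [hg', Nat.add_sub_cancel, Function.update_self]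
        omega
      · exact .inr (.inl k)
      · exact .inr (.inr (.inl k))
      · rw [hupd _ k.1]
        exact .inr (.inr (.inr k))
  · intro h
    rw [hupd _ (H.alt_bit h), Nat.add_sub_cancel, ho2, Function.update_self]
    have h1 := H.out h
    have h2 := hβ.ne o (by omega) g g1 ho2 hog
    rw [hβ.eq_of_nd g g1 c (by omega) g3] at h2
    rw [← h1]
    rw [Nat.add_sub_cancel]
    have h3 : (3 - bit (c / 2) = 1) ↔ ¬ (bit (c / 2) = 1) := by omega
    rw [h3]
    revert h2
    cases β o <;> cases β c <;> simp

/-- Both half-edges of the new edge become open ends; they share a bit but lie on opposite sides,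
which is `out`. -/
theorem Traversal.start {m nd wt mate β e bit} (H : Traversal m wt mate β e 0 0 bit)
    (hβ : HalfEdgeColoring m nd β) (he : e < m)
    (hb : bit e = 0) :
    Traversal m wt mate β (e + 1) (2 * e + 1) (2 * e + 2) (Function.update bit e 1) := by
  have hupd : ∀ i, bit i ≠ 0 → Function.update bit e 1 i = bit i := by
    intro i hi
    apply Function.update_of_ne
    rintro rfl
    exact hi hb
  have e1 : (2 * e + 1 - 1) / 2 = e := by omega
  have e2 : (2 * e + 2 - 1) / 2 = e := by omega
  constructor
  · omega
  · intro i hi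
    have := H.bit_le i hi
    rw [Function.update_apply]
    split_ifs <;> omega
  · intro i hi hw
    by_cases hie : i = e
    · simp [hie]
    · rw [Function.update_of_ne hie]
      exact H.started i (by omega) hw
  · omega
  · omega
  · intro _
    rw [e1, Function.update_self]
    omega
  · intro _
    rw [e2, Function.update_self]
    omega
  · omega
  · intro x hx hx0
    by_cases hxe : x / 2 = e
    · omega
    · rw [Function.update_of_ne hxe] at hx0 ⊢
      rcases H.closed x hx hx0 with k | k | k | k
      · omega
      · omega
      · exact .inr (.inr (.inl k))
      · rw [hupd _ k.1]
        exact .inr (.inr (.inr k))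
  · intro _
    rw [e1, e2, Function.update_self]
    have := hβ.ne (2 * e) (by omega) (2 * e + 1) (by omega) (by omega) (by omega)
    simp only [Nat.add_sub_cancel, show 2 * e + 2 - 1 = 2 * e + 1 by omega]
    revert this
    cases β (2 * e) <;> cases β (2 * e + 1) <;> simp

theorem Traversal.next {m wt mate β e bit} (H : Traversal m wt mate β e 0 0 bit) (he : e < m)
    (hb : wt e % 2 = 0 ∨ bit e ≠ 0) : Traversal m wt mate β (e + 1) 0 0 bit where
  le := he
  bit_le := H.bit_le
  started i hi hw := by
    by_cases hie : i = e
    · subst hie; omega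
    · exact H.started i (by omega) hw
  cur_le := H.cur_le
  alt_le := H.alt_le
  cur_bit := H.cur_bit
  alt_bit := H.alt_bit
  alt_eq := H.alt_eq
  closed := H.closed
  out := H.out

/-- `bit` splits the edges of odd weight into two classes, which differ by at most one at every
node. -/
structure BalancedSplit (m : ℕ) (nd wt bit : ℕ → ℕ) : Prop where
  bit_mem : ∀ i < m, wt i % 2 = 1 → bit i = 1 ∨ bit i = 2
  balanced : ∀ x, |∑ h ∈ Finset.range (2 * m) with nd h = x ∧ wt (h / 2) % 2 = 1,
    (if bit (h / 2) = 1 then 1 else -1 : ℤ)| ≤ 1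

/-- With no open end left, mated half-edges carry opposite bits. The mating is an involution that
cancels their terms, and at most one unpaired half-edge remains at the node. -/
theorem Traversal.balancedSplit {m nd wt mate β bit} (H : Traversal m wt mate β m 0 0 bit)
    (hM : Mating (2 * m) nd wt mate) : BalancedSplit m nd wt bit := by
  have hbit : ∀ i < m, wt i % 2 = 1 → bit i = 1 ∨ bit i = 2 := by
    intro i hi hw
    have := H.started i hi hw
    have := H.bit_le i hi
    omega
  refine ⟨hbit, fun x => ?_⟩
  set S := (Finset.range (2 * m)).filter fun h => nd h = x ∧ wt (h / 2) % 2 = 1 with hS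
  rw [← Finset.sum_filter_add_sum_filter_not S (fun h => mate h = 0)]
  have h1 : ∑ h ∈ S with ¬ mate h = 0, (if bit (h / 2) = 1 then 1 else -1 : ℤ) = 0 := by
    refine Finset.sum_involution (fun h _ => mate h - 1) ?_ ?_ ?_ ?_
    · intro h hh
      simp only [hS, Finset.mem_filter, Finset.mem_range] at hh
      obtain ⟨⟨h1, h2, h3⟩, h4⟩ := hh
      rcases H.closed h h1 (by have := hbit _ (by omega) h3; omega) with k | k | k | k
      · omega
      · omega
      · omega
      · obtain ⟨g, hg⟩ := Nat.exists_eq_succ_of_ne_zero h4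
        obtain ⟨a1, a2, a3, a4, a5, a6⟩ := hM.symm h h1 g hg
        rw [hg, Nat.succ_eq_add_one, Nat.add_sub_cancel] at k ⊢
        have b1 := hbit (h / 2) (by omega) h3
        have b2 := hbit (g / 2) (by omega) a6
        split_ifs <;> omega
    · intro h hh _
      simp only [hS, Finset.mem_filter, Finset.mem_range] at hh
      obtain ⟨⟨h1, h2, h3⟩, h4⟩ := hh
      obtain ⟨g, hg⟩ := Nat.exists_eq_succ_of_ne_zero h4
      obtain ⟨a1, a2, a3, a4, a5, a6⟩ := hM.symm h h1 g hg
      rw [hg]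
      exact a4
    · intro h hh
      simp only [hS, Finset.mem_filter, Finset.mem_range] at hh ⊢
      obtain ⟨⟨h1, h2, h3⟩, h4⟩ := hh
      obtain ⟨g, hg⟩ := Nat.exists_eq_succ_of_ne_zero h4
      obtain ⟨a1, a2, a3, a4, a5, a6⟩ := hM.symm h h1 g hg
      rw [hg, Nat.succ_eq_add_one, Nat.add_sub_cancel]
      exact ⟨⟨a1, a3.trans h2, a6⟩, by omega⟩
    · intro h hh
      simp only [hS, Finset.mem_filter, Finset.mem_range] at hh ⊢
      obtain ⟨⟨h1, h2, h3⟩, h4⟩ := hh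
      obtain ⟨g, hg⟩ := Nat.exists_eq_succ_of_ne_zero h4
      obtain ⟨a1, a2, a3, a4, a5, a6⟩ := hM.symm h h1 g hg
      rw [hg, Nat.succ_eq_add_one, Nat.add_sub_cancel, a2, Nat.add_sub_cancel]
  rw [h1, add_zero]
  have h2 : (S.filter fun h => mate h = 0).card ≤ 1 := by
    rw [Finset.card_le_one]
    intro a ha b hb
    simp only [hS, Finset.mem_filter, Finset.mem_range] at ha hb
    exact hM.uniq a ha.1.1 b hb.1.1 ha.1.2.2 hb.1.2.2 ha.2 hb.2 (ha.1.2.1.trans hb.1.2.1.symm)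
  refine (Finset.abs_sum_le_sum_abs _ _).trans ?_
  refine (Finset.sum_le_card_nsmul _ _ 1 fun h _ => ?_).trans ?_
  · split_ifs <;> simp
  · simpa using h2

/-! ### Programs for splitting -/

/-- The expression for half of `x`. -/
def Expr.half (x : Expr) : Expr := .div x (.lit 2)

/-- Clear the arrays `6` (mates), `7` (pending half-edges) and `8` (bits). -/
def clearSplit : Prog := .forUpTo 8 2 <|
  .seq (.put 6 (.reg 8) (.lit 0)) <|
  .seq (.put 7 (.get 3 (.reg 8)) (.lit 0)) (.put 8 (.half (.reg 8)) (.lit 0))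

/-- Compute a mating of the half-edges of odd weight. -/
def pairUp : Prog := .forUpTo 8 2 <|
  .ite (.mod (.get 5 (.half (.reg 8))) (.lit 2))
    (.seq (.set 13 (.get 7 (.get 3 (.reg 8)))) <|
      .ite (.reg 13)
        (.seq (.put 6 (.reg 8) (.reg 13)) <|
          .seq (.put 6 (.monus (.reg 13) (.lit 1)) (.add (.reg 8) (.lit 1)))
            (.put 7 (.get 3 (.reg 8)) (.lit 0)))
        (.put 7 (.get 3 (.reg 8)) (.add (.reg 8) (.lit 1))))
    .skip

/-- One step of the traversal, with the next edge in register `8`, the current half-edge in register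
`9` and the alternative one in register `10`. -/
def traverseStep : Prog :=
  .ite (.reg 9)
    (.seq (.set 13 (.get 6 (.monus (.reg 9) (.lit 1)))) <|
      .ite (.lt (.get 8 (.half (.monus (.reg 13) (.lit 1)))) (.lt (.lit 0) (.reg 13)))
        (.seq (.put 8 (.half (.monus (.reg 13) (.lit 1)))
            (.monus (.lit 3) (.get 8 (.half (.monus (.reg 9) (.lit 1)))))) <|
          .set 9 (.monus (.add (.reg 13) (.mul (.lit 2) (.mod (.reg 13) (.lit 2)))) (.lit 1)))
        (.seq (.set 9 (.reg 10)) (.set 10 (.lit 0))))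
    (.seq
      (.ite (.lt (.get 8 (.reg 8)) (.mod (.get 5 (.reg 8)) (.lit 2)))
        (.seq (.put 8 (.reg 8) (.lit 1)) <|
          .seq (.set 9 (.add (.mul (.lit 2) (.reg 8)) (.lit 1)))
            (.set 10 (.add (.mul (.lit 2) (.reg 8)) (.lit 2))))
        .skip)
      (.set 8 (.add (.reg 8) (.lit 1))))

/-- Assign the bits `1` and `2` to the edges of odd weight. -/
def traverse : Prog :=
  .seq (.set 8 (.lit 0)) <| .seq (.set 9 (.lit 0)) <| .seq (.set 10 (.lit 0)) <|
    .loop (.add (.lt (.reg 8) (.reg 1)) (.reg 9)) traverseStep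

/-- Split the edges of odd weight (array `5`) evenly with respect to the nodes in array `3`. -/
def split : Prog := .seq clearSplit (.seq pairUp traverse)

/-- Only cells of nodes that carry half-edges are cleared: the range of node numbers can be far
larger than `m`, too large to sweep in linear time. -/
theorem clearSplit_spec {w m s} (hm : s.reg 2 = 2 * m) (hw : 4 * m + 8 < 2 ^ w) :
    WP w clearSplit (16 * m + 16) (fun s' => (∀ h < 2 * m, s'.arr 6 h = 0) ∧
      (∀ h < 2 * m, s'.arr 7 (s.arr 3 h) = 0) ∧ ∀ i < m, s'.arr 8 i = 0) s := by
  refine (WP.forUpTo (N := 2 * m) (fun j s' => (∀ h < j, s'.arr 6 h = 0) ∧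
    (∀ h < j, s'.arr 7 (s.arr 3 h) = 0) ∧ ∀ h < j, s'.arr 8 (h / 2) = 0) hm (by omega) ?_ ?_
    fun _ h _ => h).mono ?_ ?_
  · simp
  · rintro j hj s' ⟨h1, h2, h3⟩ hi hb hF
    have e3 : s'.arr 3 = s.arr 3 := hF.2 3 (by decide)
    have m2 : 2 % 2 ^ w = 2 := Nat.mod_eq_of_lt (by omega)
    simp only [Prog.exec, Expr.eval, Expr.half, hi, e3, m2, Nat.zero_mod, Memory.arr_setReg,
      Memory.reg_setArr, Memory.arr_setArr]
    simp only [Nat.reduceEqDiff, if_true, if_false, Function.update_apply]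
    refine ⟨?_, ?_, ?_⟩ <;> intro h hh <;> split_ifs <;> grind
  · simp only [Prog.cost]; omega
  · rintro s' - ⟨h1, h2, h3⟩
    refine ⟨h1, h2, fun i hi => ?_⟩
    have := h3 (2 * i) (by omega)
    rwa [show 2 * i / 2 = i by omega] at this

theorem pairUp_spec {w m s} (hm : s.reg 2 = 2 * m) (hw : 4 * m + 8 < 2 ^ w)
    (h6 : ∀ h < 2 * m, s.arr 6 h = 0) (h7 : ∀ h < 2 * m, s.arr 7 (s.arr 3 h) = 0) :
    WP w pairUp (40 * m + 16) (fun s' => Mating (2 * m) (s.arr 3) (s.arr 5) (s'.arr 6)) s := by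
  refine (WP.forUpTo (N := 2 * m) (fun j s' => PartialMating (2 * m) (s.arr 3) (s.arr 5) j
    (s'.arr 6) (s'.arr 7)) hm (by omega) ?_ ?_ fun _ h _ => h).mono ?_
      (fun _ _ h => h.mating)
  · exact .zero h6 h7
  · rintro j hj s' H hi hb hF
    have e3 : s'.arr 3 = s.arr 3 := hF.2 3 (by decide)
    have e5 : s'.arr 5 = s.arr 5 := hF.2 5 (by decide)
    have m2 : 2 % 2 ^ w = 2 := Nat.mod_eq_of_lt (by omega)
    have m1 : 1 % 2 ^ w = 1 := Nat.mod_eq_of_lt (by omega)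
    have mj : (j + 1) % 2 ^ w = j + 1 := Nat.mod_eq_of_lt (by omega)
    simp only [Prog.exec, Expr.eval, Expr.half, hi, e3, e5, m2, m1, Nat.zero_mod]
    by_cases hj2 : s.arr 5 (j / 2) % 2 = 0
    · simpa [hj2] using H.succ_even hj2
    · rcases hp : s'.arr 7 (s.arr 3 j) with - | p
      · simpa [hj2, hp, hi, e3, m1, mj] using H.succ_pend hj hj2 hp
      · simpa [hj2, hp, hi, e3, m1, mj] using H.succ_pair hj hj2 hp
  · simp [Prog.cost]; omega

/-- The number of zeros among the first `m` values of `f`. -/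
def zeroCount (m : ℕ) (f : ℕ → ℕ) : ℕ := ((Finset.range m).filter fun i => f i = 0).card

theorem zeroCount_le (m : ℕ) (f : ℕ → ℕ) : zeroCount m f ≤ m :=
  (Finset.card_filter_le _ _).trans (by simp)

theorem zeroCount_update_lt {m i v : ℕ} {f : ℕ → ℕ} (hi : i < m) (h0 : f i = 0) (hv : v ≠ 0) :
    zeroCount m (Function.update f i v) < zeroCount m f := by
  apply Finset.card_lt_card
  refine Finset.ssubset_iff_of_subset ?_ |>.2 ⟨i, by simp [hi, h0], by simp [hv]⟩
  intro k
  simp only [Finset.mem_filter, Finset.mem_range, Function.update_apply]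
  split_ifs with hk
  · exact fun h => absurd h.2 hv
  · exact id

/-- The potential is three times the number of edges without a bit, plus the number of edges not yet
scanned, plus the number of open ends. A start opens two ends but uses up an edge without a bit; an
advance uses up such an edge; a retreat drops an end; a skip advances the scan. Initially the
potential is at most `4 * m`. -/
theorem traverse_spec {w m s β} (hm : s.reg 1 = m) (hw : 4 * m + 8 < 2 ^ w)
    (hM : Mating (2 * m) (s.arr 3) (s.arr 5) (s.arr 6)) (hβ : HalfEdgeColoring m (s.arr 3) β)
    (h8 : ∀ i < m, s.arr 8 i = 0) :
    WP w traverse (100 * m + 100)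
      (fun s' => BalancedSplit m (s.arr 3) (s.arr 5) (s'.arr 8)) s := by
  have m1 : 1 % 2 ^ w = 1 := Nat.mod_eq_of_lt (by omega)
  have m2 : 2 % 2 ^ w = 2 := Nat.mod_eq_of_lt (by omega)
  have m3 : 3 % 2 ^ w = 3 := Nat.mod_eq_of_lt (by omega)
  refine (WP.seq (B := 1) (WP.set fun _ => WP.seq (B := 1) (WP.set fun _ =>
    WP.seq (B := 1) (WP.set fun hF => ?_)))).mono (?_ : 1 + (1 + (1 +
      ((traverseStep.cost + 1) * (4 * m) + 1) + 1) + 1) + 1 ≤ _) fun _ _ h => h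
  · have key : ∀ s', (Frame traverseStep s s' ∧ Traversal m (s.arr 5) (s.arr 6) β (s'.reg 8)
          (s'.reg 9) (s'.reg 10) (s'.arr 8)) →
        (Expr.add (.lt (.reg 8) (.reg 1)) (.reg 9)).eval w s' ≠ 0 →
        WP w traverseStep traverseStep.cost (fun s'' => (Frame traverseStep s s'' ∧
          Traversal m (s.arr 5) (s.arr 6) β (s''.reg 8) (s''.reg 9) (s''.reg 10) (s''.arr 8)) ∧
          3 * zeroCount m (s''.arr 8) + (m - s''.reg 8) +
            (if s''.reg 9 = 0 then 0 else 1) + (if s''.reg 10 = 0 then 0 else 1) <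
          3 * zeroCount m (s'.arr 8) + (m - s'.reg 8) +
            (if s'.reg 9 = 0 then 0 else 1) + (if s'.reg 10 = 0 then 0 else 1)) s' := by
      rintro s' ⟨hF, H⟩ he
      refine (WP.of_loopFree (Q := fun s'' =>
        (Traversal m (s.arr 5) (s.arr 6) β (s''.reg 8) (s''.reg 9) (s''.reg 10) (s''.arr 8)) ∧
          3 * zeroCount m (s''.arr 8) + (m - s''.reg 8) +
            (if s''.reg 9 = 0 then 0 else 1) + (if s''.reg 10 = 0 then 0 else 1) <
          3 * zeroCount m (s'.arr 8) + (m - s'.reg 8) +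
            (if s'.reg 9 = 0 then 0 else 1) + (if s'.reg 10 = 0 then 0 else 1))
        (by decide) ?_).mono le_rfl ?_
      swap
      · rintro s'' hF' ⟨h1, h2⟩
        exact ⟨⟨⟨fun r hr => (hF'.1 r hr).trans (hF.1 r hr),
          fun a ha => (hF'.2 a ha).trans (hF.2 a ha)⟩, h1⟩, h2⟩
      have e1 : s'.reg 1 = m := (hF.1 1 (by decide)).trans hm
      have e5 : s'.arr 5 = s.arr 5 := hF.2 5 (by decide)
      have e6 : s'.arr 6 = s.arr 6 := hF.2 6 (by decide)
      have hle := H.le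
      have hcl := H.cur_le
      by_cases hc : s'.reg 9 = 0
      · have ha := H.alt_eq hc
        have hlt : s'.reg 8 < m := by
          by_contra hcon
          simp [Expr.eval, e1, hc, hcon] at he
        have m8 : (s'.reg 8 + 1) % 2 ^ w = s'.reg 8 + 1 := Nat.mod_eq_of_lt (by omega)
        have m9 : (2 * s'.reg 8) % 2 ^ w = 2 * s'.reg 8 := Nat.mod_eq_of_lt (by omega)
        have m10 : (2 * s'.reg 8 + 1) % 2 ^ w = 2 * s'.reg 8 + 1 := Nat.mod_eq_of_lt (by omega)
        have m11 : (2 * s'.reg 8 + 2) % 2 ^ w = 2 * s'.reg 8 + 2 := Nat.mod_eq_of_lt (by omega)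
        rw [hc, ha] at H
        by_cases hb : s'.arr 8 (s'.reg 8) < s.arr 5 (s'.reg 8) % 2
        · have hb0 : s'.arr 8 (s'.reg 8) = 0 := by omega
          have hb1 : s.arr 5 (s'.reg 8) % 2 = 1 := by omega
          simp [traverseStep, Prog.exec, Expr.eval, hc, ha, m1, m2, m8, m9, m10, m11, e5, hb0, hb1]
          refine ⟨H.start hβ hlt hb0, ?_⟩
          have := zeroCount_update_lt hlt hb0 one_ne_zero
          omega
        · simp [traverseStep, Prog.exec, Expr.eval, hc, ha, m1, m2, m8, e5, hb]
          exact ⟨H.next hlt (by omega), by omega⟩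
      · have hc1 : s'.reg 9 - 1 < 2 * m := by omega
        by_cases hg : s.arr 6 (s'.reg 9 - 1) ≠ 0 ∧
            s'.arr 8 ((s.arr 6 (s'.reg 9 - 1) - 1) / 2) = 0
        · have hg0 : 0 < s.arr 6 (s'.reg 9 - 1) := by omega
          obtain ⟨g, hg'⟩ := Nat.exists_eq_succ_of_ne_zero hg.1
          have hgm := (hM.symm _ hc1 g hg').1
          have hpos := H.cur_bit hc
          have hle2 := H.bit_le _ (show (s'.reg 9 - 1) / 2 < m by omega)
          have := zeroCount_update_lt (show (s.arr 6 (s'.reg 9 - 1) - 1) / 2 < m by omega) hg.2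
            (show 3 - s'.arr 8 ((s'.reg 9 - 1) / 2) ≠ 0 by omega)
          have m4 : (2 * (s.arr 6 (s'.reg 9 - 1) % 2)) % 2 ^ w =
            2 * (s.arr 6 (s'.reg 9 - 1) % 2) := Nat.mod_eq_of_lt (by omega)
          have m5 : (s.arr 6 (s'.reg 9 - 1) + 2 * (s.arr 6 (s'.reg 9 - 1) % 2)) % 2 ^ w =
            s.arr 6 (s'.reg 9 - 1) + 2 * (s.arr 6 (s'.reg 9 - 1) % 2) :=
            Nat.mod_eq_of_lt (by omega)
          have hadv := H.advance hM hβ hc hg.1 hg.2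
          simp only [opp] at hadv
          simp [traverseStep, Prog.exec, Expr.eval, Expr.half, hc, m1, m2, m3, m4, m5, e6, hg0, hg.2]
          refine ⟨hadv, ?_⟩
          split_ifs <;> omega
        · have hg2 : s.arr 6 (s'.reg 9 - 1) = 0 ∨
              s'.arr 8 ((s.arr 6 (s'.reg 9 - 1) - 1) / 2) ≠ 0 := by tauto
          -- The program tests a conjunction by one comparison: the bit is below the truth value of
          -- `0 < mate` exactly if a mate exists and its edge has no bit.
          have hif : ¬ (s'.arr 8 ((s.arr 6 (s'.reg 9 - 1) - 1) / 2) <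
              if 0 < s.arr 6 (s'.reg 9 - 1) then 1 else 0) := by
            split_ifs <;> omega
          simp only [traverseStep, Prog.exec, Expr.eval, Expr.half, m1, m2, m3, e6, ne_eq, hc,
            not_false_eq_true, if_true, Memory.reg_setReg, Memory.arr_setReg, Nat.zero_mod,
            Nat.reduceEqDiff, if_false, hif, not_true_eq_false]
          refine ⟨H.retreat hM hβ hg2, by omega⟩
    refine (WP.loop _ _ key ⟨?_, ?_⟩).mono ?_ ?_
    · constructor
      · intro r hr
        simp [traverseStep, Prog.regs] at hr
        simp [hr]
      · intro a _
        rfl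
    · simpa [Expr.eval] using Traversal.zero h8
    · simp only [Memory.arr_setReg, Memory.reg_setReg, Expr.eval, Nat.zero_mod]
      simp only [Nat.reduceEqDiff, if_true, if_false]
      have := Nat.mul_le_mul_left (traverseStep.cost + 1)
        (Nat.add_le_add_right (Nat.mul_le_mul_left 3 (zeroCount_le m (s.arr 8))) m)
      refine Nat.add_le_add_right (this.trans (Nat.mul_le_mul_left _ (by omega))) 1
    · rintro s' - ⟨⟨hF, H⟩, he⟩
      have e1 : s'.reg 1 = m := (hF.1 1 (by decide)).trans hm
      have hcl := H.cur_le
      simp only [Expr.eval, e1, m1] at he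
      rw [Nat.mod_eq_of_lt (by split_ifs <;> omega)] at he
      have hc : s'.reg 9 = 0 := by omega
      have h8' : s'.reg 8 = m := by
        have := H.le
        by_contra hcon
        rw [if_pos (by omega)] at he
        omega
      rw [H.alt_eq hc, hc, h8'] at H
      exact H.balancedSplit hM
  · simp [traverseStep, Prog.cost]; omega

theorem split_spec {w m s β} (hm : s.reg 1 = m) (hm2 : s.reg 2 = 2 * m)
    (hw : 4 * m + 8 < 2 ^ w) (hβ : HalfEdgeColoring m (s.arr 3) β) :
    WP w split (200 * m + 200)
      (fun s' => BalancedSplit m (s.arr 3) (s.arr 5) (s'.arr 8)) s := by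
  refine (WP.seq ((clearSplit_spec hm2 hw).mono le_rfl ?_)).mono
    (?_ : _ + (40 * m + 16 + (100 * m + 100) + 1) + 1 ≤ _) fun _ _ h => h
  · rintro s1 F1 ⟨h1, h2, h3⟩ -
    have e3 : s1.arr 3 = s.arr 3 := F1.2 3 (by decide)
    have e5 : s1.arr 5 = s.arr 5 := F1.2 5 (by decide)
    refine WP.seq ((pairUp_spec (m := m) ((F1.1 2 (by decide)).trans hm2) hw h1
      (by rwa [e3])).mono le_rfl ?_)
    rintro s2 F2 H -
    have e3' : s2.arr 3 = s1.arr 3 := F2.2 3 (by decide)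
    have e5' : s2.arr 5 = s1.arr 5 := F2.2 5 (by decide)
    refine (traverse_spec (m := m) (β := β)
      ((F2.1 1 (by decide)).trans ((F1.1 1 (by decide)).trans hm)) hw ?_ ?_ ?_).mono le_rfl ?_
    · rwa [e3', e5']
    · rwa [e3', e3]
    · rwa [F2.2 8 (by decide)]
    · intro s3 _ h
      rwa [e3', e5', e3, e5] at h
  · omega

/-! ### Matchings that cover the nodes of maximum degree, by repeated halving of weights -/

/-- The total weight of the half-edges below `j` at the node `x`. -/
def load (j : ℕ) (nd wt : ℕ → ℕ) (x : ℕ) : ℕ :=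
  ∑ h ∈ Finset.range j, if nd h = x then wt (h / 2) else 0

/-- Weight `1` for the uncoloured edges and `0` for the others. -/
def uncolored (col : ℕ → ℕ) (i : ℕ) : ℕ := if col i = 0 then 1 else 0

/-- The number of half-edges of uncoloured edges at the node `x`. -/
def degree (m : ℕ) (nd col : ℕ → ℕ) : ℕ → ℕ := load (2 * m) nd (uncolored col)

/-- The nodes of degree `D`. -/
def fullNodes (m : ℕ) (nd col : ℕ → ℕ) (D : ℕ) : Finset ℕ :=
  ((Finset.range (2 * m)).image nd).filter fun x => degree m nd col x = D

theorem load_congr {j nd wt wt' x} (h : ∀ i, 2 * i < j → wt i = wt' i) :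
    load j nd wt x = load j nd wt' x := by
  refine Finset.sum_congr rfl fun k hk => ?_
  rw [Finset.mem_range] at hk
  rw [h (k / 2) (by omega)]

/-- Each half-edge lies at exactly one node. The right-hand side is a sum over half-edges, which a
linear scan can handle. -/
theorem sum_load_fullNodes {m nd col D wt} :
    ∑ x ∈ fullNodes m nd col D, load (2 * m) nd wt x =
      ∑ h ∈ Finset.range (2 * m), if degree m nd col (nd h) = D then wt (h / 2) else 0 := by
  unfold load
  rw [Finset.sum_comm]
  refine Finset.sum_congr rfl fun h hh => ?_
  rw [Finset.sum_ite_eq]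
  have : nd h ∈ fullNodes m nd col D ↔ degree m nd col (nd h) = D := by
    simp only [fullNodes, Finset.mem_filter, Finset.mem_image, and_iff_right_iff_imp]
    exact fun _ => ⟨h, hh, rfl⟩
  simp only [this]

/-- Double counting: the full nodes own disjoint sets of `D` half-edges. -/
theorem mul_card_fullNodes_le {m nd col D} : D * (fullNodes m nd col D).card ≤ 2 * m := by
  have h1 : ∑ x ∈ fullNodes m nd col D, degree m nd col x =
      D * (fullNodes m nd col D).card :=
    (Finset.sum_const_nat fun x hx => (Finset.mem_filter.1 hx).2).trans (mul_comm _ _)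
  rw [← h1]
  refine (sum_load_fullNodes (wt := uncolored col)).le.trans ?_
  refine (Finset.sum_le_card_nsmul _ _ 1 fun h _ => ?_).trans (by simp)
  unfold uncolored
  split_ifs <;> simp

/-- The part of the weight `wt` that belongs to the edges of the class `c` of a split. -/
def halve (wt bit : ℕ → ℕ) (c i : ℕ) : ℕ := wt i / 2 + wt i % 2 * (if bit i = c then 1 else 0)

/-- The number of half-edges below `j` of odd weight at nodes of degree `D` in the first class
of a split. -/
def tallyOne (j : ℕ) (nd wt bit deg : ℕ → ℕ) (D : ℕ) : ℕ :=
  ∑ h ∈ Finset.range j, if wt (h / 2) % 2 = 1 ∧ deg (nd h) = D ∧ bit (h / 2) = 1 then 1 else 0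

/-- The analogue of `tallyOne` for the second class. -/
def tallyTwo (j : ℕ) (nd wt bit deg : ℕ → ℕ) (D : ℕ) : ℕ :=
  ∑ h ∈ Finset.range j, if wt (h / 2) % 2 = 1 ∧ deg (nd h) = D ∧ bit (h / 2) ≠ 1 then 1 else 0

/-- Written this way, rounding contributes exactly the signed terms that `BalancedSplit` bounds. -/
theorem two_mul_halve_one (wt bit : ℕ → ℕ) (i : ℕ) :
    (2 * halve wt bit 1 i : ℤ) =
      wt i + if wt i % 2 = 1 then (if bit i = 1 then 1 else -1) else 0 := by
  unfold halve
  split_ifs <;> push_cast <;> omega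

theorem two_mul_halve_two {wt bit : ℕ → ℕ} {i : ℕ} (hb : wt i % 2 = 1 → bit i = 1 ∨ bit i = 2) :
    (2 * halve wt bit 2 i : ℤ) =
      wt i - if wt i % 2 = 1 then (if bit i = 1 then 1 else -1) else 0 := by
  unfold halve
  split_ifs <;> push_cast <;> omega

/-- Twice the new load is the old load plus or minus the signed sum of the split at `x`. -/
theorem BalancedSplit.load_halve_le {m nd wt bit} (H : BalancedSplit m nd wt bit) {c : ℕ}
    (hc : c = 1 ∨ c = 2) (x : ℕ) :
    2 * load (2 * m) nd (halve wt bit c) x ≤ load (2 * m) nd wt x + 1 := by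
  have hb := H.balanced x
  rw [Finset.sum_filter, abs_le] at hb
  zify
  unfold load
  push_cast
  rw [Finset.mul_sum]
  rcases hc with rfl | rfl
  · have : ∑ h ∈ Finset.range (2 * m),
        (2 * if nd h = x then (halve wt bit 1 (h / 2) : ℤ) else 0) =
        ∑ h ∈ Finset.range (2 * m), (if nd h = x then (wt (h / 2) : ℤ) else 0) +
        ∑ h ∈ Finset.range (2 * m), if nd h = x ∧ wt (h / 2) % 2 = 1 then
          (if bit (h / 2) = 1 then 1 else -1 : ℤ) else 0 := by
      rw [← Finset.sum_add_distrib]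
      refine Finset.sum_congr rfl fun h hh => ?_
      have := two_mul_halve_one wt bit (h / 2)
      by_cases hx : nd h = x <;> simp [hx, this]
    linarith
  · have : ∑ h ∈ Finset.range (2 * m),
        (2 * if nd h = x then (halve wt bit 2 (h / 2) : ℤ) else 0) =
        ∑ h ∈ Finset.range (2 * m), (if nd h = x then (wt (h / 2) : ℤ) else 0) -
        ∑ h ∈ Finset.range (2 * m), if nd h = x ∧ wt (h / 2) % 2 = 1 then
          (if bit (h / 2) = 1 then 1 else -1 : ℤ) else 0 := by
      rw [← Finset.sum_sub_distrib]
      refine Finset.sum_congr rfl fun h hh => ?_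
      rw [Finset.mem_range] at hh
      have := two_mul_halve_two (H.bit_mem (h / 2) (by omega))
      by_cases hx : nd h = x <;> simp [hx, this]
    linarith

/-- The weight on the nodes of degree `D` is at least halved by taking the better class. -/
theorem BalancedSplit.le_sum_halve {m nd wt bit} (H : BalancedSplit m nd wt bit) (deg : ℕ → ℕ)
    (D : ℕ) {c : ℕ} (hc : c = if tallyOne (2 * m) nd wt bit deg D <
      tallyTwo (2 * m) nd wt bit deg D then 2 else 1) :
    ∑ h ∈ Finset.range (2 * m), (if deg (nd h) = D then wt (h / 2) else 0) ≤
      2 * ∑ h ∈ Finset.range (2 * m), if deg (nd h) = D then halve wt bit c (h / 2) else 0 := by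
  rw [← Nat.cast_le (α := ℤ), Finset.mul_sum]
  -- The total rounding over the full nodes is the difference of the two tallies, so its sign tells
  -- which class to prefer.
  have key : ∑ h ∈ Finset.range (2 * m), (if deg (nd h) = D then
      (if wt (h / 2) % 2 = 1 then (if bit (h / 2) = 1 then 1 else -1) else 0) else 0 : ℤ) =
      (tallyOne (2 * m) nd wt bit deg D : ℤ) - tallyTwo (2 * m) nd wt bit deg D := by
    unfold tallyOne tallyTwo
    push_cast
    rw [← Finset.sum_sub_distrib]
    refine Finset.sum_congr rfl fun h hh => ?_
    by_cases h1 : deg (nd h) = D <;> by_cases h2 : wt (h / 2) % 2 = 1 <;>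
      by_cases h3 : bit (h / 2) = 1 <;> simp [h1, h2, h3]
  split_ifs at hc with hlt <;> subst hc
  · have : ∑ h ∈ Finset.range (2 * m),
        (2 * if deg (nd h) = D then (halve wt bit 2 (h / 2) : ℤ) else 0) =
        ∑ h ∈ Finset.range (2 * m), (if deg (nd h) = D then (wt (h / 2) : ℤ) else 0) -
        ∑ h ∈ Finset.range (2 * m), (if deg (nd h) = D then
      (if wt (h / 2) % 2 = 1 then (if bit (h / 2) = 1 then 1 else -1) else 0) else 0 : ℤ) := by
      rw [← Finset.sum_sub_distrib]
      refine Finset.sum_congr rfl fun h hh => ?_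
      rw [Finset.mem_range] at hh
      have := two_mul_halve_two (H.bit_mem (h / 2) (by omega))
      by_cases hx : deg (nd h) = D <;> simp [hx, this]
    push_cast
    rw [this, key]
    have : (tallyOne (2 * m) nd wt bit deg D : ℤ) < tallyTwo (2 * m) nd wt bit deg D := by
      exact_mod_cast hlt
    linarith
  · have : ∑ h ∈ Finset.range (2 * m),
        (2 * if deg (nd h) = D then (halve wt bit 1 (h / 2) : ℤ) else 0) =
        ∑ h ∈ Finset.range (2 * m), (if deg (nd h) = D then (wt (h / 2) : ℤ) else 0) +
        ∑ h ∈ Finset.range (2 * m), (if deg (nd h) = D then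
      (if wt (h / 2) % 2 = 1 then (if bit (h / 2) = 1 then 1 else -1) else 0) else 0 : ℤ) := by
      rw [← Finset.sum_add_distrib]
      refine Finset.sum_congr rfl fun h hh => ?_
      have := two_mul_halve_one wt bit (h / 2)
      by_cases hx : deg (nd h) = D <;> simp [hx, this]
    push_cast
    rw [this, key]
    have : (tallyTwo (2 * m) nd wt bit deg D : ℤ) ≤ tallyOne (2 * m) nd wt bit deg D := by
      exact_mod_cast not_lt.1 hlt
    linarith

/-- `wt` is a weight of uncoloured edges with load at most `T` at every node, for which the
nodes of degree `D` together miss less than `T` of the maximum possible load. -/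
structure NearPerfect (m : ℕ) (nd col : ℕ → ℕ) (D T : ℕ) (wt : ℕ → ℕ) : Prop where
  load_le : ∀ x, load (2 * m) nd wt x ≤ T
  heavy : T * (fullNodes m nd col D).card <
    T + ∑ x ∈ fullNodes m nd col D, load (2 * m) nd wt x
  active : ∀ i < m, wt i ≠ 0 → col i = 0

theorem NearPerfect.congr {m nd col D T wt wt'} (H : NearPerfect m nd col D T wt)
    (h : ∀ i < m, wt i = wt' i) : NearPerfect m nd col D T wt' := by
  have e : ∀ x, load (2 * m) nd wt x = load (2 * m) nd wt' x :=
    fun x => load_congr fun i hi => h i (by omega)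
  refine ⟨fun x => e x ▸ H.load_le x, ?_, fun i hi hw => H.active i hi (h i hi ▸ hw)⟩
  simpa only [e] using H.heavy

/-- A full node has load `D * ⌊T / D⌋` and misses `T % D < D`. If there are full nodes, they miss
together less than `D` times their number, hence less than `2 * m ≤ T`; otherwise `0 < T` suffices.
-/
theorem NearPerfect.initial {m nd col D T} (hT : 0 < T) (hmT : 2 * m ≤ T) (hD : 0 < D)
    (hdeg : ∀ x, degree m nd col x ≤ D) :
    NearPerfect m nd col D T fun i => if col i = 0 then T / D else 0 := by
  have e : ∀ x, load (2 * m) nd (fun i => if col i = 0 then T / D else 0) x =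
      T / D * degree m nd col x := by
    intro x
    unfold degree load
    rw [Finset.mul_sum]
    refine Finset.sum_congr rfl fun h _ => ?_
    unfold uncolored
    by_cases h1 : nd h = x <;> by_cases h2 : col (h / 2) = 0 <;> simp [h1, h2]
  refine ⟨fun x => ?_, ?_, fun i _ hi => ?_⟩
  · rw [e]
    exact (Nat.mul_le_mul_left _ (hdeg x)).trans (Nat.div_mul_le_self _ _)
  · have h1 : ∑ x ∈ fullNodes m nd col D,
        load (2 * m) nd (fun i => if col i = 0 then T / D else 0) x =
        (fullNodes m nd col D).card * (T / D * D) := by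
      refine Finset.sum_const_nat fun x hx => ?_
      rw [e, (Finset.mem_filter.1 hx).2]
    rw [h1]
    have h2 := Nat.div_add_mod' T D
    have h3 := Nat.mod_lt T hD
    have h4 := mul_card_fullNodes_le (m := m) (nd := nd) (col := col) (D := D)
    generalize (fullNodes m nd col D).card = f at *
    have h5 : T % D * f < T := by
      rcases Nat.eq_zero_or_pos f with rfl | hf
      · simpa
      · exact (Nat.mul_lt_mul_of_pos_right h3 hf).trans_le (h4.trans hmT)
    calc T * f = (T / D * D + T % D) * f := by rw [h2]
      _ = T % D * f + f * (T / D * D) := by ring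
      _ < _ := by omega
  · by_contra hc
    simp [hc] at hi

/-- Loads become at most `(2 * T + 1) / 2`, which is `T` by integrality. The weight on the full
nodes is at least halved by `le_sum_halve`, so the strict inequality survives division by two. -/
theorem NearPerfect.halve {m nd col D T wt bit c} (H : NearPerfect m nd col D (2 * T) wt)
    (hS : BalancedSplit m nd wt bit)
    (hc : c = if tallyOne (2 * m) nd wt bit (degree m nd col) D <
      tallyTwo (2 * m) nd wt bit (degree m nd col) D then 2 else 1) :
    NearPerfect m nd col D T (halve wt bit c) := by
  refine ⟨fun x => ?_, ?_, fun i hi h => H.active i hi ?_⟩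
  · have h1 := hS.load_halve_le (c := c) (by split_ifs at hc <;> simp [hc]) x
    have h2 := H.load_le x
    omega
  · have h1 := hS.le_sum_halve _ D hc
    have h2 := H.heavy
    rw [sum_load_fullNodes] at h2 ⊢
    rw [mul_assoc] at h2
    omega
  · rintro h0
    simp [WordRAM.halve, h0] at h

/-- The total deficit of the full nodes is an integer below one, and no node can make up for another
because no load exceeds one. -/
theorem NearPerfect.load_eq_one {m nd col D wt} (H : NearPerfect m nd col D 1 wt) {x}
    (hx : x ∈ fullNodes m nd col D) : load (2 * m) nd wt x = 1 := by
  by_contra hne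
  have h0 : load (2 * m) nd wt x = 0 := by have := H.load_le x; omega
  have h1 := H.heavy
  rw [← Finset.add_sum_erase _ _ hx, h0] at h1
  have h2 : ∑ y ∈ (fullNodes m nd col D).erase x, load (2 * m) nd wt y ≤
      ((fullNodes m nd col D).erase x).card := by
    refine (Finset.sum_le_card_nsmul _ _ 1 fun y _ => H.load_le y).trans (by simp)
  rw [Finset.card_erase_of_mem hx] at h2
  have := Finset.card_pos.2 ⟨x, hx⟩
  omega

/-! ### The levels of the colouring algorithm -/

/-- The state of the colouring of a multigraph with `m` edges, whose half-edges are attached to the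
vertices `v`: the colours up to `used` are in use, the uncoloured edges are divided into `K` classes
of maximum degree at most `D`, and `nd h` encodes the vertex and the class of the half-edge `h`. -/
structure Level (m : ℕ) (v : ℕ → ℕ) (Δ D K used : ℕ) (nd col : ℕ → ℕ) : Prop where
  colors : K * D + used = Δ
  pos : 0 < K
  node : ∀ h < 2 * m, nd h / K = v h
  class_eq : ∀ h < 2 * m, ∀ g < 2 * m, h / 2 = g / 2 → nd h % K = nd g % K
  degree_le : ∀ x, degree m nd col x ≤ D
  color_le : ∀ i < m, col i ≤ used
  proper : ∀ h < 2 * m, ∀ g < 2 * m, h / 2 ≠ g / 2 → v h = v g → col (h / 2) ≠ 0 →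
    col (h / 2) ≠ col (g / 2)

theorem Level.congr {m v Δ D K used nd col nd' col'} (H : Level m v Δ D K used nd col)
    (hn : ∀ h < 2 * m, nd h = nd' h) (hc : ∀ i < m, col i = col' i) :
    Level m v Δ D K used nd' col' where
  colors := H.colors
  pos := H.pos
  node h hh := hn h hh ▸ H.node h hh
  class_eq h hh g hg e := by rw [← hn h hh, ← hn g hg]; exact H.class_eq h hh g hg e
  degree_le x := by
    refine le_of_eq_of_le ?_ (H.degree_le x)
    unfold degree load
    refine Finset.sum_congr rfl fun h hh => ?_
    rw [Finset.mem_range] at hh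
    rw [uncolored, uncolored, hn h hh, hc (h / 2) (by omega)]
  color_le i hi := hc i hi ▸ H.color_le i hi
  proper h hh g hg := by
    rw [← hc (h / 2) (by omega), ← hc (g / 2) (by omega)]
    exact H.proper h hh g hg

theorem Level.initial {m v Δ col} (hcol : ∀ i < m, col i = 0)
    (h : ∀ x, degree m v col x ≤ Δ) : Level m v Δ Δ 1 0 v col where
  colors := by simp
  pos := one_pos
  node h _ := Nat.div_one _
  class_eq h _ g _ _ := by simp [Nat.mod_one]
  degree_le := h
  color_le i hi := (hcol i hi).le
  proper h hh g hg _ _ hc := absurd (hcol _ (by omega)) hc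

theorem Level.ne_zero {m v Δ K used nd col} (H : Level m v Δ 0 K used nd col) {i} (hi : i < m) :
    col i ≠ 0 := by
  intro hc
  have h := Nat.le_zero.1 (H.degree_le (nd (2 * i)))
  unfold degree load at h
  have := Finset.sum_eq_zero_iff.1 h (2 * i) (Finset.mem_range.2 (by omega))
  simp [uncolored, hc] at this

/-- With loads at most one, this makes the edges of weight one a matching. -/
theorem load_pair_le {M nd wt h g} (hh : h < M) (hg : g < M) (hne : h ≠ g) (e : nd h = nd g) :
    wt (h / 2) + wt (g / 2) ≤ load M nd wt (nd h) := by
  have := Finset.sum_le_sum_of_subset (f := fun k => if nd k = nd h then wt (k / 2) else 0)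
    (show ({h, g} : Finset ℕ) ⊆ Finset.range M by
      intro k; simp; rintro (rfl | rfl) <;> assumption)
  rw [Finset.sum_pair hne] at this
  simpa [e, load] using this

/-- Give fresh colours to the edges of a matching that covers the nodes of degree `D`. -/
theorem Level.color_matching {m v Δ D K used nd col wt} (H : Level m v Δ (D + 1) K used nd col)
    (hW : NearPerfect m nd col (D + 1) 1 wt) :
    Level m v Δ D K (used + K) nd
      (fun i => if wt i = 1 then used + nd (2 * i) % K + 1 else col i) where
  colors := by rw [← H.colors]; ring
  pos := H.pos
  node := H.node
  class_eq := H.class_eq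
  degree_le x := by
    have hle : ∀ h ∈ Finset.range (2 * m), (if nd h = x then uncolored (fun i => if wt i = 1 then
        used + nd (2 * i) % K + 1 else col i) (h / 2) else 0) ≤
        if nd h = x then uncolored col (h / 2) else 0 := by
      intro h _
      unfold uncolored
      by_cases h1 : nd h = x <;> by_cases h2 : wt (h / 2) = 1 <;> simp [h1, h2]
    -- A node of degree `D + 1` has load one, so one of its edges gets coloured; any other node
    -- already has degree at most `D`.
    by_cases hx : degree m nd col x = D + 1
    · have hmem : x ∈ fullNodes m nd col (D + 1) := by
        refine Finset.mem_filter.2 ⟨?_, hx⟩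
        by_contra hc
        have : degree m nd col x = 0 := by
          unfold degree load
          refine Finset.sum_eq_zero fun h hh => if_neg fun e => hc ?_
          exact Finset.mem_image.2 ⟨h, hh, e⟩
        omega
      have h1 := hW.load_eq_one hmem
      obtain ⟨h, hh, hne⟩ : ∃ h ∈ Finset.range (2 * m),
          (if nd h = x then wt (h / 2) else 0) ≠ 0 := by
        by_contra hc
        push Not at hc
        rw [load, Finset.sum_eq_zero hc] at h1
        omega
      have hx' : nd h = x := by by_contra hc; simp [hc] at hne
      rw [if_pos hx'] at hne
      have hw1 : wt (h / 2) = 1 := by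
        have := Finset.single_le_sum (f := fun k => if nd k = x then wt (k / 2) else 0)
          (fun _ _ => Nat.zero_le _) hh
        simp only [hx', if_true] at this
        change _ ≤ load (2 * m) nd wt x at this
        omega
      refine Nat.le_of_lt_succ (lt_of_lt_of_eq (Finset.sum_lt_sum hle ⟨h, hh, ?_⟩) hx)
      have := hW.active (h / 2) (by rw [Finset.mem_range] at hh; omega) hne
      simp [uncolored, hx', hw1, this]
    · have h1 := H.degree_le x
      have h2 : degree m nd (fun i => if wt i = 1 then used + nd (2 * i) % K + 1 else col i) x ≤
        degree m nd col x := Finset.sum_le_sum hle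
      omega
  color_le i hi := by
    have := H.color_le i hi
    have := Nat.mod_lt (nd (2 * i)) H.pos
    split_ifs <;> omega
  proper h hh g hg hne hv := by
    have a1 := H.color_le (h / 2) (by omega)
    have a2 := H.color_le (g / 2) (by omega)
    split_ifs with h1 h2 h2
    -- Equal fresh colours mean equal classes. With a common vertex the half-edges lie at a common
    -- node, whose load would be at least two.
    · intro _ he
      have e1 := H.class_eq (2 * (h / 2)) (by omega) h hh (by omega)
      have e2 := H.class_eq (2 * (g / 2)) (by omega) g hg (by omega)
      have e3 : nd h = nd g := by
        rw [← Nat.div_add_mod (nd h) K, ← Nat.div_add_mod (nd g) K, H.node h hh, H.node g hg, hv]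
        omega
      have := load_pair_le (wt := wt) hh hg (by rintro rfl; exact hne rfl) e3
      have := hW.load_le (nd h)
      omega
    · omega
    · omega
    · exact H.proper h hh g hg hne hv

/-- Divide every class into two of half the degree. -/
theorem Level.split {m v Δ D K used nd col bit} (H : Level m v Δ (2 * D) K used nd col)
    (hS : BalancedSplit m nd (uncolored col) bit) :
    Level m v Δ D (2 * K) used (fun h => 2 * nd h + if bit (h / 2) = 1 then 1 else 0) col where
  colors := by rw [← H.colors]; ring
  pos := by have := H.pos; omega
  node h hh := by
    rw [← H.node h hh, ← Nat.div_div_eq_div_mul]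
    congr 1
    split_ifs <;> omega
  class_eq h hh g hg e := by
    -- Modulo `2 * K`, the new label consists of the bit and the old class.
    rw [Nat.mod_mul, Nat.mod_mul, e]
    have h1 := H.class_eq h hh g hg e
    split_ifs
    · rw [show (2 * nd h + 1) / 2 = nd h by omega, show (2 * nd g + 1) / 2 = nd g by omega]
      omega
    · rw [show (2 * nd h + 0) / 2 = nd h by omega, show (2 * nd g + 0) / 2 = nd g by omega]
      omega
  degree_le x := by
    have h1 := hS.load_halve_le (c := if x % 2 = 1 then 1 else 2)
      (by split_ifs <;> simp) (x / 2)
    have h2 := H.degree_le (x / 2)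
    -- The node `x` is the part of the old node `x / 2` in the class given by the parity of `x`. For
    -- weights `0` and `1`, `halve` is the indicator of the uncoloured edges of that class.
    have h3 : degree m (fun h => 2 * nd h + if bit (h / 2) = 1 then 1 else 0) col x ≤
        load (2 * m) nd (halve (uncolored col) bit (if x % 2 = 1 then 1 else 2)) (x / 2) := by
      unfold degree load
      refine Finset.sum_le_sum fun h hh => ?_
      rw [Finset.mem_range] at hh
      have hb := hS.bit_mem (h / 2) (by omega)
      by_cases hc : col (h / 2) = 0
      · have hu : uncolored col (h / 2) = 1 := by simp [uncolored, hc]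
        have hb := hb (by rw [hu])
        simp only [halve, hu]
        split_ifs <;> omega
      · have hu : uncolored col (h / 2) = 0 := by simp [uncolored, hc]
        simp [hu]
    change load (2 * m) nd (uncolored col) (x / 2) ≤ 2 * D at h2
    omega
  color_le := H.color_le
  proper := H.proper

/-! ### The programs for the levels -/

/-- Compute the degrees of all nodes with respect to the uncoloured edges, in array `4`. -/
def countDegrees : Prog :=
  .seq (.forUpTo 8 2 (.put 4 (.get 3 (.reg 8)) (.lit 0))) <|
    .forUpTo 8 2 <| .ite (.get 2 (.half (.reg 8))) .skip
      (.put 4 (.get 3 (.reg 8)) (.add (.get 4 (.get 3 (.reg 8))) (.lit 1)))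

/-- Give the weight in register `14` to every uncoloured edge, and the weight `0` to the others. -/
def setWeights : Prog :=
  .forUpTo 8 1 <| .ite (.get 2 (.reg 8)) (.put 5 (.reg 8) (.lit 0)) (.put 5 (.reg 8) (.reg 14))

/-- Count the half-edges of odd weight at nodes of the degree in register `3`, in register `11` for
the first class and in register `12` for the second one. -/
def tally : Prog :=
  .seq (.set 11 (.lit 0)) <| .seq (.set 12 (.lit 0)) <| .forUpTo 8 2 <|
    .ite (.mod (.get 5 (.half (.reg 8))) (.lit 2))
      (.ite (.eq (.get 4 (.get 3 (.reg 8))) (.reg 3))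
        (.ite (.eq (.get 8 (.half (.reg 8))) (.lit 1))
          (.set 11 (.add (.reg 11) (.lit 1)))
          (.set 12 (.add (.reg 12) (.lit 1))))
        .skip)
      .skip

/-- Pass to the part of the weights that belongs to the class in register `13`. -/
def halveWeights : Prog :=
  .forUpTo 8 1 <| .put 5 (.reg 8) <| .add (.half (.get 5 (.reg 8)))
    (.mul (.mod (.get 5 (.reg 8)) (.lit 2)) (.eq (.get 8 (.reg 8)) (.reg 13)))

/-- Halve the weights and the bound on the load in register `7`. -/
def round : Prog :=
  .seq split <| .seq tally <| .seq (.set 13 (.add (.lit 1) (.lt (.reg 11) (.reg 12)))) <|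
    .seq halveWeights (.set 7 (.half (.reg 7)))

/-- Give fresh colours to the edges of weight `1`. -/
def assignColors : Prog :=
  .forUpTo 8 1 <| .ite (.eq (.get 5 (.reg 8)) (.lit 1))
    (.put 2 (.reg 8) (.add (.add (.reg 5)
      (.mod (.get 3 (.mul (.lit 2) (.reg 8))) (.reg 4))) (.lit 1)))
    .skip

/-- Colour a matching that covers the nodes of maximum degree. -/
def matchStep : Prog :=
  .seq countDegrees <| .seq (.set 7 (.reg 6)) <| .seq (.set 14 (.div (.reg 7) (.reg 3))) <|
    .seq setWeights <| .seq (.loop (.lt (.lit 1) (.reg 7)) round) <| .seq assignColors <|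
      .seq (.set 5 (.add (.reg 5) (.reg 4))) (.set 3 (.monus (.reg 3) (.lit 1)))

/-- Refine the nodes according to the classes of the split. -/
def refineNodes : Prog :=
  .forUpTo 8 2 <| .put 3 (.reg 8) <|
    .add (.mul (.lit 2) (.get 3 (.reg 8))) (.eq (.get 8 (.half (.reg 8))) (.lit 1))

/-- Divide every class of uncoloured edges into two classes of half the degree. -/
def splitStep : Prog :=
  .seq (.set 14 (.lit 1)) <| .seq setWeights <| .seq split <| .seq refineNodes <|
    .seq (.set 4 (.mul (.lit 2) (.reg 4))) (.set 3 (.half (.reg 3)))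

/-- Proceed to the next level. -/
def levelStep : Prog := .seq (.ite (.mod (.reg 3) (.lit 2)) matchStep .skip) splitStep

/-! ### Correctness of the level programs -/

theorem load_le_of_le_one {j nd wt x} (h : ∀ i, wt i ≤ 1) : load j nd wt x ≤ j := by
  refine (Finset.sum_le_card_nsmul _ _ 1 fun k _ => ?_).trans (by simp)
  split_ifs
  · exact h _
  · simp

theorem uncolored_le_one (col : ℕ → ℕ) (i : ℕ) : uncolored col i ≤ 1 := by
  unfold uncolored
  split_ifs <;> simp

theorem countDegrees_spec {w m s} (hm : s.reg 2 = 2 * m) (hw : 4 * m + 8 < 2 ^ w) :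
    WP w countDegrees (20 * m + 20) (fun s' => ∀ h < 2 * m,
      s'.arr 4 (s.arr 3 h) = degree m (s.arr 3) (s.arr 2) (s.arr 3 h)) s := by
  have m1 : 1 % 2 ^ w = 1 := Nat.mod_eq_of_lt (by omega)
  have m2 : 2 % 2 ^ w = 2 := Nat.mod_eq_of_lt (by omega)
  refine (WP.seq (B' := 10 * m + 3) (WP.forUpTo (N := 2 * m)
    (fun j s' => ∀ h < j, s'.arr 4 (s.arr 3 h) = 0) hm (by omega) (by simp) ?_ ?_)).mono
    (by simp [Prog.cost]; omega) fun _ _ h => h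
  · intro j hj s' H hi hb hF
    have e3 : s'.arr 3 = s.arr 3 := hF.2 3 (by decide)
    simp only [Prog.exec, Expr.eval, hi, e3, Nat.zero_mod, Memory.arr_setReg, Memory.arr_setArr,
      if_true, Function.update_apply]
    intro h hh
    split_ifs with h1
    · rfl
    · exact H h (by grind)
  · intro s1 H F1 _
    have f3 : s1.arr 3 = s.arr 3 := F1.2 3 (by decide)
    have f2 : s1.arr 2 = s.arr 2 := F1.2 2 (by decide)
    refine (WP.forUpTo (N := 2 * m) (fun j s' => ∀ h < 2 * m, s'.arr 4 (s.arr 3 h) =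
      load j (s.arr 3) (uncolored (s.arr 2)) (s.arr 3 h)) ((F1.1 2 (by decide)).trans hm) (by omega)
      (by simpa [load] using H) ?_ fun s' h _ => h).mono
      (by simp [Prog.cost]; omega) fun s' _ h => h
    intro j hj s' H hi hb hF
    have e3 : s'.arr 3 = s.arr 3 := (hF.2 3 (by decide)).trans f3
    have e2 : s'.arr 2 = s.arr 2 := (hF.2 2 (by decide)).trans f2
    have hle : load j (s.arr 3) (uncolored (s.arr 2)) (s.arr 3 j) ≤ j :=
      load_le_of_le_one (uncolored_le_one _)
    have m3 : (load j (s.arr 3) (uncolored (s.arr 2)) (s.arr 3 j) + 1) % 2 ^ w =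
      load j (s.arr 3) (uncolored (s.arr 2)) (s.arr 3 j) + 1 := Nat.mod_eq_of_lt (by omega)
    intro h hh
    have hsucc : load (j + 1) (s.arr 3) (uncolored (s.arr 2)) (s.arr 3 h) =
        load j (s.arr 3) (uncolored (s.arr 2)) (s.arr 3 h) +
        if s.arr 3 j = s.arr 3 h then uncolored (s.arr 2) (j / 2) else 0 :=
      Finset.sum_range_succ _ _
    rw [hsucc]
    have Hh := H h hh
    have Hj := H j hj
    by_cases hc : s.arr 2 (j / 2) = 0
    · simp only [Prog.exec, Expr.eval, Expr.half, hi, e3, e2, m1, m2, hc, ne_eq, not_true_eq_false,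
        if_false, Memory.arr_setReg, Memory.arr_setArr, if_true, Function.update_apply, Hj, m3, Hh,
        uncolored]
      by_cases hn : s.arr 3 h = s.arr 3 j
      · simp [hn]
      · simp [hn, Ne.symm hn]
    · simp [Prog.exec, Expr.eval, Expr.half, hi, e2, m2, hc, Hh, uncolored]

theorem setWeights_spec {w m s} (hm : s.reg 1 = m) (hw : 4 * m + 8 < 2 ^ w) :
    WP w setWeights (20 * m + 20) (fun s' => ∀ i < m,
      s'.arr 5 i = if s.arr 2 i = 0 then s.reg 14 else 0) s := by
  refine (WP.forUpTo (N := m) (fun j s' => ∀ i < j,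
      s'.arr 5 i = if s.arr 2 i = 0 then s.reg 14 else 0) hm (by omega) (by simp) ?_
      fun s' h _ => h).mono (by simp [Prog.cost]; omega) fun s' _ h => h
  intro j hj s' H hi hb hF i hij
  have e2 : s'.arr 2 = s.arr 2 := hF.2 2 (by decide)
  have e14 : s'.reg 14 = s.reg 14 := hF.1 14 (by decide)
  by_cases hij' : i = j
  · subst hij'
    by_cases hc : s.arr 2 i = 0 <;> simp [Prog.exec, Expr.eval, hi, e2, e14, hc]
  · have := H i (by omega)
    by_cases hc : s.arr 2 j = 0 <;> simp [Prog.exec, Expr.eval, hi, e2, e14, hc, hij', this]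

theorem tallyOne_succ (j : ℕ) (nd wt bit deg : ℕ → ℕ) (D : ℕ) :
    tallyOne (j + 1) nd wt bit deg D = tallyOne j nd wt bit deg D +
      if wt (j / 2) % 2 = 1 ∧ deg (nd j) = D ∧ bit (j / 2) = 1 then 1 else 0 :=
  Finset.sum_range_succ _ _

theorem tallyTwo_succ (j : ℕ) (nd wt bit deg : ℕ → ℕ) (D : ℕ) :
    tallyTwo (j + 1) nd wt bit deg D = tallyTwo j nd wt bit deg D +
      if wt (j / 2) % 2 = 1 ∧ deg (nd j) = D ∧ bit (j / 2) ≠ 1 then 1 else 0 :=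
  Finset.sum_range_succ _ _

theorem tally_spec {w m s} (hm : s.reg 2 = 2 * m) (hw : 4 * m + 8 < 2 ^ w) :
    WP w tally (30 * m + 30) (fun s' =>
      s'.reg 11 = tallyOne (2 * m) (s.arr 3) (s.arr 5) (s.arr 8) (s.arr 4) (s.reg 3) ∧
      s'.reg 12 = tallyTwo (2 * m) (s.arr 3) (s.arr 5) (s.arr 8) (s.arr 4) (s.reg 3)) s := by
  have m1 : 1 % 2 ^ w = 1 := Nat.mod_eq_of_lt (by omega)
  have m2 : 2 % 2 ^ w = 2 := Nat.mod_eq_of_lt (by omega)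
  refine (WP.seq (B := 1) (WP.set fun _ => WP.seq (B := 1) (WP.set fun F1 =>
    WP.forUpTo (N := 2 * m) (fun j s' =>
      s'.reg 11 = tallyOne j (s.arr 3) (s.arr 5) (s.arr 8) (s.arr 4) (s.reg 3) ∧
      s'.reg 12 = tallyTwo j (s.arr 3) (s.arr 5) (s.arr 8) (s.arr 4) (s.reg 3))
      (by simpa using hm) (by omega) (by simp [tallyOne, tallyTwo, Expr.eval]) ?_
      fun s' h _ => h))).mono (by simp [Prog.cost]; omega) fun s' _ h => h
  rintro j hj s' ⟨H1, H2⟩ hi hb hF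
  have e3 : s'.arr 3 = s.arr 3 := hF.2 3 (by decide)
  have e4 : s'.arr 4 = s.arr 4 := hF.2 4 (by decide)
  have e5 : s'.arr 5 = s.arr 5 := hF.2 5 (by decide)
  have e8 : s'.arr 8 = s.arr 8 := hF.2 8 (by decide)
  have er : s'.reg 3 = s.reg 3 := hF.1 3 (by decide)
  have hle1 : tallyOne j (s.arr 3) (s.arr 5) (s.arr 8) (s.arr 4) (s.reg 3) ≤ j :=
    (Finset.sum_le_card_nsmul _ _ 1 fun k _ => by split_ifs <;> simp).trans (by simp)
  have hle2 : tallyTwo j (s.arr 3) (s.arr 5) (s.arr 8) (s.arr 4) (s.reg 3) ≤ j :=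
    (Finset.sum_le_card_nsmul _ _ 1 fun k _ => by split_ifs <;> simp).trans (by simp)
  have m3 := Nat.mod_eq_of_lt (show tallyOne j (s.arr 3) (s.arr 5) (s.arr 8) (s.arr 4) (s.reg 3) + 1
    < 2 ^ w by omega)
  have m4 := Nat.mod_eq_of_lt (show tallyTwo j (s.arr 3) (s.arr 5) (s.arr 8) (s.arr 4) (s.reg 3) + 1
    < 2 ^ w by omega)
  rw [tallyOne_succ, tallyTwo_succ]
  by_cases h1 : s.arr 5 (j / 2) % 2 = 0
  · simp [Prog.exec, Expr.eval, Expr.half, hi, e5, m2, h1, H1, H2]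
  · have h1' : s.arr 5 (j / 2) % 2 = 1 := by omega
    by_cases h2 : s.arr 4 (s.arr 3 j) = s.reg 3
    · by_cases h3 : s.arr 8 (j / 2) = 1
      · simp [Prog.exec, Expr.eval, Expr.half, hi, e3, e4, e5, e8, er, m1, m2, h1', h2, h3]
        exact ⟨by rw [H1, m3], H2⟩
      · simp [Prog.exec, Expr.eval, Expr.half, hi, e3, e4, e5, e8, er, m1, m2, h1', h2, h3]
        exact ⟨H1, by rw [H2, m4]⟩
    · simp [Prog.exec, Expr.eval, Expr.half, hi, e3, e4, e5, er, m2, h1', h2, H1, H2]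

theorem halveWeights_spec {w m s} (hm : s.reg 1 = m) (hw : 4 * m + 8 < 2 ^ w)
    (hwt : ∀ i < m, s.arr 5 i < 2 ^ w) :
    WP w halveWeights (20 * m + 20)
      (fun s' => ∀ i < m, s'.arr 5 i = halve (s.arr 5) (s.arr 8) (s.reg 13) i) s := by
  have m1 : 1 % 2 ^ w = 1 := Nat.mod_eq_of_lt (by omega)
  have m2 : 2 % 2 ^ w = 2 := Nat.mod_eq_of_lt (by omega)
  -- The update is in place, so the invariant also records that the cells from `j` on still hold the
  -- old weights.
  refine (WP.forUpTo (N := m) (fun j s' => ∀ i < m, s'.arr 5 i =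
      if i < j then halve (s.arr 5) (s.arr 8) (s.reg 13) i else s.arr 5 i) hm (by omega) (by simp) ?_
      fun s' h _ i hi => by simpa [hi] using h i hi).mono (by simp [Prog.cost]; omega)
      fun s' _ h => h
  intro j hj s' H hi hb hF i him
  have e8 : s'.arr 8 = s.arr 8 := hF.2 8 (by decide)
  have er : s'.reg 13 = s.reg 13 := hF.1 13 (by decide)
  by_cases hij : i = j
  · subst hij
    have h5 := H i hj
    rw [if_neg (lt_irrefl _)] at h5
    have := hwt i hj
    simp only [Prog.exec, Expr.eval, Expr.half, hi, e8, er, m1, m2, h5, Memory.arr_setReg,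
      Memory.arr_setArr, if_true, Function.update_self, Nat.lt_succ_self, halve]
    have b1 : s.arr 5 i % 2 * (if s.arr 8 i = s.reg 13 then 1 else 0) < 2 ^ w := by
      split_ifs <;> omega
    rw [Nat.mod_eq_of_lt b1]
    apply Nat.mod_eq_of_lt
    split_ifs <;> omega
  · have := H i him
    simp only [Prog.exec, hi, Expr.eval, Memory.arr_setReg, Memory.arr_setArr, if_true,
      Function.update_of_ne hij, this]
    congr 1
    simp; omega

theorem NearPerfect.weight_le {m nd col D T wt} (H : NearPerfect m nd col D T wt) {i : ℕ}
    (hi : i < m) : wt i ≤ T := by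
  have h := H.load_le (nd (2 * i))
  have := Finset.single_le_sum (f := fun k => if nd k = nd (2 * i) then wt (k / 2) else 0)
    (fun _ _ => Nat.zero_le _) (Finset.mem_range.2 (show 2 * i < 2 * m by omega))
  simp only [if_true, show 2 * i / 2 = i by omega] at this
  exact this.trans h

/-- The computed degrees are known to be right only at nodes of half-edges; the tallies look at no
others. -/
theorem tally_congr {j nd wt bit deg deg'} (D : ℕ) (h : ∀ k < j, deg (nd k) = deg' (nd k)) :
    tallyOne j nd wt bit deg D = tallyOne j nd wt bit deg' D ∧
      tallyTwo j nd wt bit deg D = tallyTwo j nd wt bit deg' D := by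
  constructor <;> refine Finset.sum_congr rfl fun k hk => ?_ <;>
    rw [h k (Finset.mem_range.1 hk)]

theorem round_spec {w m s β D T} (hm : s.reg 1 = m) (hm2 : s.reg 2 = 2 * m) (hD : s.reg 3 = D)
    (hT : s.reg 7 = 2 * T) (hw : 4 * m + 8 < 2 ^ w) (hTw : 2 * T < 2 ^ w)
    (hβ : HalfEdgeColoring m (s.arr 3) β)
    (hdeg : ∀ h < 2 * m, s.arr 4 (s.arr 3 h) = degree m (s.arr 3) (s.arr 2) (s.arr 3 h))
    (H : NearPerfect m (s.arr 3) (s.arr 2) D (2 * T) (s.arr 5)) :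
    WP w round (300 * m + 300) (fun s' => s'.reg 7 = T ∧
      NearPerfect m (s.arr 3) (s.arr 2) D T (s'.arr 5)) s := by
  have m1 : 1 % 2 ^ w = 1 := Nat.mod_eq_of_lt (by omega)
  have m2 : 2 % 2 ^ w = 2 := Nat.mod_eq_of_lt (by omega)
  refine (WP.seq (B' := 30 * m + 30 + (1 + (20 * m + 20 + 1 + 1) + 1) + 1)
    ((split_spec hm hm2 hw hβ).mono le_rfl ?_)).mono (by omega) fun s' _ h => h
  intro s1 F1 hS _
  have a3 : s1.arr 3 = s.arr 3 := F1.2 3 (by decide)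
  have a4 : s1.arr 4 = s.arr 4 := F1.2 4 (by decide)
  have a5 : s1.arr 5 = s.arr 5 := F1.2 5 (by decide)
  have r1 : s1.reg 1 = m := (F1.1 1 (by decide)).trans hm
  have r2 : s1.reg 2 = 2 * m := (F1.1 2 (by decide)).trans hm2
  have r3 : s1.reg 3 = D := (F1.1 3 (by decide)).trans hD
  have r7 : s1.reg 7 = 2 * T := (F1.1 7 (by decide)).trans hT
  refine WP.seq ((tally_spec r2 hw).mono le_rfl ?_)
  rintro s2 F2 ⟨t1, t2⟩ -
  have b5 : s2.arr 5 = s.arr 5 := (F2.2 5 (by decide)).trans a5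
  have b8 : s2.arr 8 = s1.arr 8 := F2.2 8 (by decide)
  have q1 : s2.reg 1 = m := (F2.1 1 (by decide)).trans r1
  have q7 : s2.reg 7 = 2 * T := (F2.1 7 (by decide)).trans r7
  rw [a3, a4, a5, r3, (tally_congr D hdeg).1] at t1
  rw [a3, a4, a5, r3, (tally_congr D hdeg).2] at t2
  refine WP.seq (WP.set fun _ => WP.seq (B := 20 * m + 20) (B' := 1)
    ((halveWeights_spec (m := m) ?_ hw ?_).mono le_rfl ?_))
  · simpa using q1
  · intro i hi
    rw [Memory.arr_setReg, b5]
    exact (H.weight_le hi).trans_lt hTw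
  · rintro s3 F3 h5 -
    have q7' : s3.reg 7 = 2 * T := by
      rw [F3.1 7 (by decide)]
      simpa using q7
    have hc : (Expr.add (.lit 1) (.lt (.reg 11) (.reg 12))).eval w s2 =
        if s2.reg 11 < s2.reg 12 then 2 else 1 := by
      simp only [Expr.eval, m1]
      split_ifs <;> simp [m1, m2]
    refine WP.set ⟨?_, ?_⟩
    · simp [Expr.eval, Expr.half, m2, q7']
    · refine (H.halve hS (c := if s2.reg 11 < s2.reg 12 then 2 else 1) (by rw [t1, t2])).congr ?_
      intro i hi
      rw [Memory.arr_setReg, h5 i hi]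
      simp [hc, b5, b8]

theorem rounds_spec {w m s β D t} (hm : s.reg 1 = m) (hm2 : s.reg 2 = 2 * m) (hD : s.reg 3 = D)
    (hT : s.reg 7 = 2 ^ t) (hw : 4 * m + 8 < 2 ^ w) (hTw : 2 ^ t < 2 ^ w)
    (hβ : HalfEdgeColoring m (s.arr 3) β)
    (hdeg : ∀ h < 2 * m, s.arr 4 (s.arr 3 h) = degree m (s.arr 3) (s.arr 2) (s.arr 3 h))
    (H : NearPerfect m (s.arr 3) (s.arr 2) D (2 ^ t) (s.arr 5)) :
    WP w (.loop (.lt (.lit 1) (.reg 7)) round) ((300 * m + 301) * t + 1)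
      (fun s' => NearPerfect m (s.arr 3) (s.arr 2) D 1 (s'.arr 5)) s := by
  have m1 : 1 % 2 ^ w = 1 := Nat.mod_eq_of_lt (by omega)
  -- The bound on the load stays a power of two: halving it is exact, and its logarithm counts the
  -- rounds.
  refine (WP.loop_frame (B := 300 * m + 300) (fun s' => ∃ j ≤ t, s'.reg 7 = 2 ^ j ∧
    NearPerfect m (s.arr 3) (s.arr 2) D (2 ^ j) (s'.arr 5)) (fun s' => Nat.log 2 (s'.reg 7)) ?_
    ⟨t, le_rfl, hT, H⟩).mono ?_ ?_
  · rintro s' F ⟨j, hj, h7, hN⟩ he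
    have h1 : 1 < s'.reg 7 := by
      by_contra hc
      simp [Expr.eval, m1, hc] at he
    obtain ⟨j, rfl⟩ : ∃ i, j = i + 1 := by
      refine Nat.exists_eq_succ_of_ne_zero ?_
      rintro rfl
      simp [h7] at h1
    have e3 : s'.arr 3 = s.arr 3 := F.2 3 (by decide)
    have e4 : s'.arr 4 = s.arr 4 := F.2 4 (by decide)
    have e2 : s'.arr 2 = s.arr 2 := F.2 2 (by decide)
    have hp : 2 ^ (j + 1) = 2 * 2 ^ j := by ring
    have hle : 2 ^ (j + 1) ≤ 2 ^ t := Nat.pow_le_pow_right (by omega) hj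
    refine (round_spec (m := m) (β := β) (D := D) (T := 2 ^ j) ((F.1 1 (by decide)).trans hm)
      ((F.1 2 (by decide)).trans hm2) ((F.1 3 (by decide)).trans hD) (by omega) hw (by omega)
      (by rwa [e3]) (by rwa [e3, e4, e2]) (by rwa [e3, e2, ← hp])).mono le_rfl ?_
    rintro s'' - ⟨k1, k2⟩
    rw [e3, e2] at k2
    refine ⟨⟨j, by omega, k1, k2⟩, ?_⟩
    rw [k1, h7, Nat.log_pow one_lt_two, Nat.log_pow one_lt_two]
    omega
  · rw [hT, Nat.log_pow one_lt_two]
  · rintro s' F ⟨⟨j, hj, h7, hN⟩, he⟩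
    have : j = 0 := by
      by_contra hc
      have : 1 < 2 ^ j := Nat.one_lt_two_pow hc
      simp [Expr.eval, m1, h7, this] at he
    subst this
    simpa using hN

theorem assignColors_spec {w m s} (hm : s.reg 1 = m) (hw : 4 * m + 8 < 2 ^ w)
    (hK : 0 < s.reg 4) (hc : s.reg 5 + s.reg 4 < 2 ^ w) :
    WP w assignColors (20 * m + 20) (fun s' => ∀ i < m, s'.arr 2 i =
      if s.arr 5 i = 1 then s.reg 5 + s.arr 3 (2 * i) % s.reg 4 + 1 else s.arr 2 i) s := by
  have m1 : 1 % 2 ^ w = 1 := Nat.mod_eq_of_lt (by omega)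
  have m2 : 2 % 2 ^ w = 2 := Nat.mod_eq_of_lt (by omega)
  refine (WP.forUpTo (N := m) (fun j s' => ∀ i < m, s'.arr 2 i = if i < j then
      (if s.arr 5 i = 1 then s.reg 5 + s.arr 3 (2 * i) % s.reg 4 + 1 else s.arr 2 i) else s.arr 2 i)
      hm (by omega) (by simp) ?_
      fun s' h _ i hi => by simpa [hi] using h i hi).mono (by simp [Prog.cost]; omega)
      fun s' _ h => h
  intro j hj s' H hi hb hF i him
  have e3 : s'.arr 3 = s.arr 3 := hF.2 3 (by decide)
  have e5 : s'.arr 5 = s.arr 5 := hF.2 5 (by decide)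
  have r4 : s'.reg 4 = s.reg 4 := hF.1 4 (by decide)
  have r5 : s'.reg 5 = s.reg 5 := hF.1 5 (by decide)
  have mj : 2 * j % 2 ^ w = 2 * j := Nat.mod_eq_of_lt (by omega)
  have hlt := Nat.mod_lt (s.arr 3 (2 * j)) hK
  have mc : (s.reg 5 + s.arr 3 (2 * j) % s.reg 4) % 2 ^ w = s.reg 5 + s.arr 3 (2 * j) % s.reg 4 :=
    Nat.mod_eq_of_lt (by omega)
  have md : (s.reg 5 + s.arr 3 (2 * j) % s.reg 4 + 1) % 2 ^ w =
    s.reg 5 + s.arr 3 (2 * j) % s.reg 4 + 1 := Nat.mod_eq_of_lt (by omega)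
  have := H i him
  by_cases hij : i = j
  · subst hij
    rw [if_neg (lt_irrefl _)] at this
    by_cases h5 : s.arr 5 i = 1
    · simp only [Prog.exec, Expr.eval, hi, e3, e5, r4, r5, m1, m2, mj, mc, md, h5, if_true, ne_eq,
        one_ne_zero, not_false_eq_true, Memory.arr_setReg, Memory.arr_setArr,
        Function.update_self, Nat.lt_succ_self]
    · simp [Prog.exec, Expr.eval, hi, e5, m1, h5, this]
  · have hlt : i < j + 1 ↔ i < j := by omega
    simp only [hlt]
    by_cases h5 : s.arr 5 j = 1
    · simp only [Prog.exec, Expr.eval, hi, e3, e5, r4, r5, m1, m2, mj, mc, md, h5, if_true, ne_eq,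
        one_ne_zero, not_false_eq_true, Memory.arr_setReg, Memory.arr_setArr,
        Function.update_of_ne hij, this]
    · simpa [Prog.exec, Expr.eval, hi, e5, m1, h5] using this

/-- Nodes refine vertices, so bipartiteness passes to every level. -/
theorem HalfEdgeColoring.of_level {m v Δ D K used nd col β} (hβ : HalfEdgeColoring m v β)
    (H : Level m v Δ D K used nd col) : HalfEdgeColoring m nd β where
  eq_of_nd h hh g hg e := hβ.eq_of_nd h hh g hg (by rw [← H.node h hh, ← H.node g hg, e])
  ne := hβ.ne

/-- Different classes have disjoint nodes, so a single sequence of `t` rounds serves all `K`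
classes, whatever `K` is. -/
theorem matchStep_spec {w m v Δ D K used s β t} (hm : s.reg 1 = m) (hm2 : s.reg 2 = 2 * m)
    (hD : s.reg 3 = D + 1) (hK : s.reg 4 = K) (hu : s.reg 5 = used) (hT : s.reg 6 = 2 ^ t)
    (hmT : 2 * m ≤ 2 ^ t) (hw : 4 * m + 8 < 2 ^ w) (hTw : 2 ^ t < 2 ^ w) (hΔ : Δ < 2 ^ w)
    (hβ : HalfEdgeColoring m v β)
    (H : Level m v Δ (D + 1) K used (s.arr 3) (s.arr 2)) :
    WP w matchStep ((300 * m + 301) * t + 60 * m + 100) (fun s' =>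
      s'.reg 3 = D ∧ s'.reg 5 = used + K ∧
      Level m v Δ D K (used + K) (s.arr 3) (s'.arr 2)) s := by
  have hK0 := H.pos
  have hcol := H.colors
  have hle : K + used ≤ Δ := by rw [← hcol, Nat.mul_succ]; omega
  have m1 : 1 % 2 ^ w = 1 := Nat.mod_eq_of_lt (by omega)
  refine (WP.seq (B' := 1 + (1 + (20 * m + 20 + ((300 * m + 301) * t + 1 + (20 * m + 20 +
    (1 + 1 + 1) + 1) + 1) + 1) + 1) + 1) ((countDegrees_spec hm2 hw).mono le_rfl ?_)).mono
    (by omega) fun s' _ h => h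
  intro s1 F1 hdeg _
  have a2 : s1.arr 2 = s.arr 2 := F1.2 2 (by decide)
  have a3 : s1.arr 3 = s.arr 3 := F1.2 3 (by decide)
  have r1 : s1.reg 1 = m := (F1.1 1 (by decide)).trans hm
  have r2 : s1.reg 2 = 2 * m := (F1.1 2 (by decide)).trans hm2
  have r3 : s1.reg 3 = D + 1 := (F1.1 3 (by decide)).trans hD
  have r4 : s1.reg 4 = K := (F1.1 4 (by decide)).trans hK
  have r5 : s1.reg 5 = used := (F1.1 5 (by decide)).trans hu
  have r6 : s1.reg 6 = 2 ^ t := (F1.1 6 (by decide)).trans hT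
  refine WP.seq (WP.set fun _ => WP.seq (WP.set fun _ => WP.seq
    ((setWeights_spec (m := m) (by simpa using r1) hw).mono le_rfl ?_)))
  intro s2 F2 hwt _
  have b2 : s2.arr 2 = s.arr 2 := (F2.2 2 (by decide)).trans a2
  have b3 : s2.arr 3 = s.arr 3 := (F2.2 3 (by decide)).trans a3
  have b4 : s2.arr 4 = s1.arr 4 := F2.2 4 (by decide)
  have q1 : s2.reg 1 = m := by rw [F2.1 1 (by decide)]; simpa using r1
  have q2 : s2.reg 2 = 2 * m := by rw [F2.1 2 (by decide)]; simpa using r2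
  have q3 : s2.reg 3 = D + 1 := by rw [F2.1 3 (by decide)]; simpa using r3
  have q4 : s2.reg 4 = K := by rw [F2.1 4 (by decide)]; simpa using r4
  have q5 : s2.reg 5 = used := by rw [F2.1 5 (by decide)]; simpa using r5
  have q7 : s2.reg 7 = 2 ^ t := by rw [F2.1 7 (by decide)]; simpa [Expr.eval] using r6
  have hN : NearPerfect m (s2.arr 3) (s2.arr 2) (D + 1) (2 ^ t) (s2.arr 5) := by
    rw [b2, b3]
    refine (NearPerfect.initial (Nat.two_pow_pos t) hmT D.succ_pos H.degree_le).congr fun i hi => ?_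
    rw [hwt i hi]
    simp [Expr.eval, r6, r3, a2]
  refine WP.seq ((rounds_spec q1 q2 q3 q7 hw hTw (by rw [b3]; exact hβ.of_level H)
    (by rwa [b4, b3, b2]) hN).mono le_rfl ?_)
  intro s3 F3 hN1 _
  have c2 : s3.arr 2 = s.arr 2 := (F3.2 2 (by decide)).trans b2
  have c3 : s3.arr 3 = s.arr 3 := (F3.2 3 (by decide)).trans b3
  have p1 : s3.reg 1 = m := (F3.1 1 (by decide)).trans q1
  have p3 : s3.reg 3 = D + 1 := (F3.1 3 (by decide)).trans q3
  have p4 : s3.reg 4 = K := (F3.1 4 (by decide)).trans q4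
  have p5 : s3.reg 5 = used := (F3.1 5 (by decide)).trans q5
  refine WP.seq (B := 20 * m + 20) (B' := 1 + 1 + 1)
    ((assignColors_spec p1 hw (by omega) (by omega)).mono le_rfl ?_)
  intro s4 F4 hcols _
  have o3 : s4.reg 3 = D + 1 := (F4.1 3 (by decide)).trans p3
  have o4 : s4.reg 4 = K := (F4.1 4 (by decide)).trans p4
  have o5 : s4.reg 5 = used := (F4.1 5 (by decide)).trans p5
  refine WP.seq (WP.set fun _ => WP.set ⟨?_, ?_, ?_⟩)
  · simp [Expr.eval, o3, m1]
  · simp only [Memory.reg_setReg, Expr.eval, o4, o5, Nat.reduceEqDiff, if_true, if_false]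
    exact Nat.mod_eq_of_lt (by omega)
  · rw [b3, b2] at hN1
    refine (H.color_matching hN1).congr (fun _ _ => rfl) fun i hi => ?_
    simp only [Memory.arr_setReg]
    rw [hcols i hi, c2, c3, p4, p5]

theorem refineNodes_spec {w m s} (hm : s.reg 2 = 2 * m) (hw : 4 * m + 8 < 2 ^ w)
    (hn : ∀ h < 2 * m, 2 * s.arr 3 h + 1 < 2 ^ w) :
    WP w refineNodes (20 * m + 20) (fun s' => ∀ h < 2 * m, s'.arr 3 h =
      2 * s.arr 3 h + if s.arr 8 (h / 2) = 1 then 1 else 0) s := by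
  have m1 : 1 % 2 ^ w = 1 := Nat.mod_eq_of_lt (by omega)
  have m2 : 2 % 2 ^ w = 2 := Nat.mod_eq_of_lt (by omega)
  refine (WP.forUpTo (N := 2 * m) (fun j s' => ∀ h < 2 * m, s'.arr 3 h = if h < j then
      (2 * s.arr 3 h + if s.arr 8 (h / 2) = 1 then 1 else 0) else s.arr 3 h)
      hm (by omega) (by simp) ?_
      fun s' h _ i hi => by simpa [hi] using h i hi).mono (by simp [Prog.cost]; omega)
      fun s' _ h => h
  intro j hj s' H hi hb hF i him
  have e8 : s'.arr 8 = s.arr 8 := hF.2 8 (by decide)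
  have := H i him
  by_cases hij : i = j
  · subst hij
    rw [if_neg (lt_irrefl _)] at this
    have hlt := hn i him
    have mi : 2 * s.arr 3 i % 2 ^ w = 2 * s.arr 3 i := Nat.mod_eq_of_lt (by omega)
    simp only [Prog.exec, Expr.eval, Expr.half, hi, e8, m1, m2, this, mi, if_true,
      Memory.arr_setReg, Memory.arr_setArr, Function.update_self, Nat.lt_succ_self]
    apply Nat.mod_eq_of_lt
    split_ifs <;> omega
  · have hlt : i < j + 1 ↔ i < j := by omega
    simp only [hlt, Prog.exec, Expr.eval, hi, if_true, Memory.arr_setReg, Memory.arr_setArr,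
      Function.update_of_ne hij, this]

theorem BalancedSplit.congr {m nd wt wt' bit} (H : BalancedSplit m nd wt bit)
    (h : ∀ i < m, wt i = wt' i) : BalancedSplit m nd wt' bit where
  bit_mem i hi hw := H.bit_mem i hi (by rwa [h i hi])
  balanced x := by
    convert H.balanced x using 3
    refine Finset.filter_congr fun k hk => ?_
    rw [Finset.mem_range] at hk
    rw [h (k / 2) (by omega)]

theorem splitStep_spec {w m v n Δ D K used s β} (hm : s.reg 1 = m) (hm2 : s.reg 2 = 2 * m)
    (hD : s.reg 3 / 2 = D) (hK : s.reg 4 = K) (hw : 4 * m + 8 < 2 ^ w)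
    (hnK : 2 * (n * K) + 2 * K + 1 < 2 ^ w) (hv : ∀ h < 2 * m, v h < n)
    (hβ : HalfEdgeColoring m v β)
    (H : Level m v Δ (2 * D) K used (s.arr 3) (s.arr 2)) :
    WP w splitStep (300 * m + 300) (fun s' => s'.reg 3 = D ∧ s'.reg 4 = 2 * K ∧
      Level m v Δ D (2 * K) used (s'.arr 3) (s.arr 2)) s := by
  have m1 : 1 % 2 ^ w = 1 := Nat.mod_eq_of_lt (by omega)
  have m2 : 2 % 2 ^ w = 2 := Nat.mod_eq_of_lt (by omega)
  refine (WP.seq (B := 1) (B' := 20 * m + 20 + (200 * m + 200 + (20 * m + 20 + (1 + 1 + 1) + 1) + 1)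
    + 1) (WP.set fun _ => WP.seq ((setWeights_spec (m := m) (by simpa using hm) hw).mono le_rfl ?_)))
    |>.mono (by omega) fun s' _ h => h
  intro s1 F1 hwt _
  have a3 : s1.arr 3 = s.arr 3 := F1.2 3 (by decide)
  have r1 : s1.reg 1 = m := by rw [F1.1 1 (by decide)]; simpa using hm
  have r2 : s1.reg 2 = 2 * m := by rw [F1.1 2 (by decide)]; simpa using hm2
  have r3 : s1.reg 3 / 2 = D := by rw [F1.1 3 (by decide)]; simpa using hD
  have r4 : s1.reg 4 = K := by rw [F1.1 4 (by decide)]; simpa using hK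
  refine WP.seq ((split_spec r1 r2 hw (by rw [a3]; exact hβ.of_level H)).mono le_rfl ?_)
  intro s2 F2 hS _
  have b3 : s2.arr 3 = s.arr 3 := (F2.2 3 (by decide)).trans a3
  have q2 : s2.reg 2 = 2 * m := (F2.1 2 (by decide)).trans r2
  have q3 : s2.reg 3 / 2 = D := by rw [F2.1 3 (by decide)]; exact r3
  have q4 : s2.reg 4 = K := (F2.1 4 (by decide)).trans r4
  refine WP.seq (B := 20 * m + 20) (B' := 1 + 1 + 1)
    ((refineNodes_spec q2 hw ?_).mono le_rfl ?_)
  · intro h hh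
    have h1 := H.node h hh
    have h2 := hv h hh
    -- Node numbers lie below `n * K`, so the refined ones still fit into a word.
    rw [← h1, Nat.div_lt_iff_lt_mul H.pos] at h2
    rw [b3]
    omega
  · intro s3 F3 hnd _
    have p3 : s3.reg 3 / 2 = D := by rw [F3.1 3 (by decide)]; exact q3
    have p4 : s3.reg 4 = K := (F3.1 4 (by decide)).trans q4
    refine WP.seq (WP.set fun _ => WP.set ⟨?_, ?_, ?_⟩)
    · simpa [Expr.eval, Expr.half, m2] using p3
    · simp only [Memory.reg_setReg, Expr.eval, p4, m2, Nat.reduceEqDiff, if_true, if_false]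
      exact Nat.mod_eq_of_lt (by omega)
    · have hS' : BalancedSplit m (s.arr 3) (uncolored (s.arr 2)) (s2.arr 8) := by
        rw [a3] at hS
        refine hS.congr fun i hi => ?_
        rw [hwt i hi]
        simp [uncolored, Expr.eval, m1]
      refine (H.split hS').congr (fun h hh => ?_) fun _ _ => rfl
      simp only [Memory.arr_setReg]
      rw [hnd h hh, b3]

theorem levelStep_spec {w m v n Δ D K used s β t} (hm : s.reg 1 = m) (hm2 : s.reg 2 = 2 * m)
    (hD : s.reg 3 = D) (hD0 : D ≠ 0) (hK : s.reg 4 = K) (hu : s.reg 5 = used)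
    (hT : s.reg 6 = 2 ^ t)
    (hmT : 2 * m ≤ 2 ^ t) (hw : 4 * m + 8 < 2 ^ w) (hTw : 2 ^ t < 2 ^ w)
    (hΔ : 2 * (n * Δ) + 2 * Δ + 1 < 2 ^ w) (hv : ∀ h < 2 * m, v h < n)
    (hβ : HalfEdgeColoring m v β)
    (H : Level m v Δ D K used (s.arr 3) (s.arr 2)) :
    WP w levelStep ((300 * m + 301) * t + 400 * m + 500) (fun s' =>
      s'.reg 3 = D / 2 ∧ s'.reg 4 = 2 * K ∧
      Level m v Δ (D / 2) (2 * K) (s'.reg 5) (s'.arr 3) (s'.arr 2)) s := by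
  have m2 : 2 % 2 ^ w = 2 := Nat.mod_eq_of_lt (by omega)
  -- From `K * D + used = Δ` with `D ≠ 0`; this bounds the node numbers uniformly over all levels.
  have hKΔ : K ≤ Δ := by
    rw [← H.colors]
    exact (Nat.le_mul_of_pos_right K (Nat.pos_of_ne_zero hD0)).trans (Nat.le_add_right _ _)
  have hnK : n * K ≤ n * Δ := Nat.mul_le_mul_left n hKΔ
  refine (WP.seq (B := (300 * m + 301) * t + 60 * m + 100 + 1) (B' := 300 * m + 300)
    (Q := fun s' => s'.reg 3 = D / 2 ∧ s'.reg 4 = 2 * K ∧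
      Level m v Δ (D / 2) (2 * K) (s'.reg 5) (s'.arr 3) (s'.arr 2)) ?_).mono
    (by omega) fun s' _ h => h
  have key : ∀ s1, Frame matchStep s s1 → s1.reg 3 / 2 = D / 2 →
      Level m v Δ (2 * (D / 2)) K (s1.reg 5) (s.arr 3) (s1.arr 2) →
      WP w splitStep (300 * m + 300) (fun s' => s'.reg 3 = D / 2 ∧ s'.reg 4 = 2 * K ∧
        Level m v Δ (D / 2) (2 * K) (s'.reg 5) (s'.arr 3) (s'.arr 2)) s1 := by
    intro s1 F1 h3 hL
    refine (splitStep_spec (n := n) (K := K) ((F1.1 1 (by decide)).trans hm)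
      ((F1.1 2 (by decide)).trans hm2)
      h3 ((F1.1 4 (by decide)).trans hK) hw (by omega) hv hβ
      (by rw [F1.2 3 (by decide)]; exact hL)).mono le_rfl ?_
    rintro s' F2 ⟨h1, h2, h4⟩
    rw [F2.1 5 (by decide), F2.2 2 (by decide)]
    exact ⟨h1, h2, h4⟩
  refine WP.ite (fun he => ?_) (fun he => ?_)
  · have hodd : D % 2 = 1 := by
      simp only [Expr.eval, m2, hD] at he
      omega
    obtain ⟨E, rfl⟩ : ∃ E, D = 2 * E + 1 := ⟨D / 2, by omega⟩
    refine (matchStep_spec hm hm2 hD hK hu hT hmT hw hTw (by omega) hβ H).mono le_rfl ?_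
    rintro s1 F1 ⟨h3, h5, hL⟩ -
    have e : (2 * E + 1) / 2 = E := by omega
    refine key s1 F1 (by omega) ?_
    rwa [e, h5]
  · have heven : D % 2 = 0 := by simpa only [Expr.eval, m2, hD] using he
    refine ⟨_, _, .skip s, by omega, fun _ => key s (Frame.refl _ _) (by rw [hD]) ?_⟩
    rwa [show 2 * (D / 2) = D by omega, hu]

/-! ### The main program -/

/-- The vertex of the half-edge `h`, when `src` and `tgt` list the endpoints of the edges. -/
def endpoint (src tgt : ℕ → ℕ) (h : ℕ) : ℕ := if h % 2 = 0 then src (h / 2) else tgt (h / 2)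

/-- Write the endpoints of all half-edges into array `3`. -/
def initNodes : Prog :=
  .forUpTo 8 1 <| .seq (.put 3 (.mul (.lit 2) (.reg 8)) (.get 0 (.reg 8)))
    (.put 3 (.add (.mul (.lit 2) (.reg 8)) (.lit 1)) (.get 1 (.reg 8)))

/-- Compute the maximum degree in register `3`. -/
def maxDegree : Prog :=
  .forUpTo 8 2 <| .ite (.lt (.reg 3) (.get 4 (.get 3 (.reg 8))))
    (.set 3 (.get 4 (.get 3 (.reg 8)))) .skip

/-- The edge-colouring program. -/
def edgeColoring : Prog :=
  .seq (.set 2 (.mul (.lit 2) (.reg 1))) <| .seq initNodes <| .seq countDegrees <|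
    .seq maxDegree <| .seq (.set 4 (.lit 1)) <| .seq (.set 6 (.lit 1)) <|
      .seq (.loop (.lt (.reg 6) (.reg 2)) (.set 6 (.mul (.lit 2) (.reg 6))))
        (.loop (.reg 3) levelStep)

theorem initNodes_spec {w m s} (hm : s.reg 1 = m) (hw : 4 * m + 8 < 2 ^ w) :
    WP w initNodes (20 * m + 20) (fun s' => ∀ h < 2 * m, s'.arr 3 h =
      endpoint (s.arr 0) (s.arr 1) h) s := by
  have m1 : 1 % 2 ^ w = 1 := Nat.mod_eq_of_lt (by omega)
  have m2 : 2 % 2 ^ w = 2 := Nat.mod_eq_of_lt (by omega)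
  refine (WP.forUpTo (N := m) (fun j s' => ∀ h < 2 * j, s'.arr 3 h =
      endpoint (s.arr 0) (s.arr 1) h) hm (by omega) (by simp) ?_ fun s' h _ => h).mono
      (by simp [Prog.cost]; omega) fun s' _ h => h
  intro j hj s' H hi hb hF h hh
  have e0 : s'.arr 0 = s.arr 0 := hF.2 0 (by decide)
  have e1 : s'.arr 1 = s.arr 1 := hF.2 1 (by decide)
  have mj : 2 * j % 2 ^ w = 2 * j := Nat.mod_eq_of_lt (by omega)
  have mk : (2 * j + 1) % 2 ^ w = 2 * j + 1 := Nat.mod_eq_of_lt (by omega)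
  simp only [Prog.exec, Expr.eval, hi, e0, e1, m1, m2, mj, mk, Memory.arr_setReg, Memory.reg_setArr,
    Memory.arr_setArr, Function.update_apply, if_true, Nat.reduceEqDiff, if_false, endpoint]
  by_cases h1 : h = 2 * j + 1
  · simp [h1, show (2 * j + 1) / 2 = j by omega]
  · by_cases h2 : h = 2 * j
    · simp [h2]
    · simpa [h1, h2, endpoint] using H h (by omega)

theorem maxDegree_spec {w m s Δ} {deg : ℕ → ℕ} (hm2 : s.reg 2 = 2 * m) (hw : 4 * m + 8 < 2 ^ w)
    (h3 : s.reg 3 = 0) (hdeg : ∀ h < 2 * m, s.arr 4 (s.arr 3 h) = deg h)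
    (hle : ∀ h < 2 * m, deg h ≤ Δ) (hex : Δ = 0 ∨ ∃ h < 2 * m, deg h = Δ) :
    WP w maxDegree (20 * m + 20) (fun s' => s'.reg 3 = Δ) s := by
  have m1 : 1 % 2 ^ w = 1 := Nat.mod_eq_of_lt (by omega)
  refine (WP.forUpTo (N := 2 * m) (fun j s' => s'.reg 3 ≤ Δ ∧ ∀ h < j, deg h ≤ s'.reg 3)
    hm2 (by omega) (by simp [h3]) ?_ fun s' h _ => h).mono (by simp [Prog.cost]; omega) ?_
  · rintro j hj s' ⟨H1, H2⟩ hi hb hF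
    have e3 : s'.arr 3 = s.arr 3 := hF.2 3 (by decide)
    have e4 : s'.arr 4 = s.arr 4 := hF.2 4 (by decide)
    have hd := hdeg j hj
    have hl := hle j hj
    by_cases hc : s'.reg 3 < deg j
    · simp [Prog.exec, Expr.eval, hi, e3, e4, hd, hc, m1]
      refine ⟨hl, fun h hh => ?_⟩
      rcases Nat.lt_or_eq_of_le hh with hh | rfl
      · exact (H2 h hh).trans hc.le
      · exact le_rfl
    · simp [Prog.exec, Expr.eval, hi, e3, e4, hd, hc]
      refine ⟨H1, fun h hh => ?_⟩
      rcases Nat.lt_or_eq_of_le hh with hh | rfl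
      · exact H2 h hh
      · omega
  · rintro s' - ⟨H1, H2⟩
    rcases hex with rfl | ⟨h, hh, rfl⟩
    · omega
    · exact le_antisymm H1 (H2 h hh)

theorem edgeColoring_spec {w m n s Δ β} {v : ℕ → ℕ} (hm : s.reg 1 = m) (h3 : s.reg 3 = 0)
    (h5 : s.reg 5 = 0) (hcol : ∀ i < m, s.arr 2 i = 0) (hvdef : v = endpoint (s.arr 0) (s.arr 1))
    (hw : 4 * m + 8 < 2 ^ w) (hΔw : 2 * (n * Δ) + 2 * Δ + 1 < 2 ^ w) (hv : ∀ h < 2 * m, v h < n)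
    (hβ : HalfEdgeColoring m v β) (hle : ∀ x, load (2 * m) v (fun _ => 1) x ≤ Δ)
    (hex : Δ = 0 ∨ ∃ h < 2 * m, load (2 * m) v (fun _ => 1) (v h) = Δ) :
    WP w edgeColoring (1000 * (m + 1) * (Nat.log 2 (4 * m + 1) + 1) * (Nat.log 2 (2 * Δ) + 1))
      (fun s' => ∃ K used nd, Level m v Δ 0 K used nd (s'.arr 2)) s := by
  have m1 : 1 % 2 ^ w = 1 := Nat.mod_eq_of_lt (by omega)
  have m2 : 2 % 2 ^ w = 2 := Nat.mod_eq_of_lt (by omega)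
  set A := (300 * m + 301) * Nat.log 2 (4 * m + 1) + 400 * m + 500 with hA
  refine (WP.seq (B := 1) (B' := 20 * m + 20 + (20 * m + 20 + (20 * m + 20 + (1 + (1 + (
    (1 + 1) * (2 * m) + 1 + ((A + 1) * Nat.log 2 (2 * Δ) + 1) + 1) + 1) + 1) + 1) + 1) + 1)
    (WP.set fun _ => WP.seq
    ((initNodes_spec (m := m) (by simpa using hm) hw).mono le_rfl ?_))).mono ?_ fun s' _ h => h
  swap
  · have hA' : A + 1 ≤ 501 * (m + 1) * (Nat.log 2 (4 * m + 1) + 1) := by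
      rw [hA]; nlinarith [Nat.zero_le (m * Nat.log 2 (4 * m + 1))]
    have h1 : (A + 1) * Nat.log 2 (2 * Δ) ≤
      501 * (m + 1) * (Nat.log 2 (4 * m + 1) + 1) * Nat.log 2 (2 * Δ) := Nat.mul_le_mul_right _ hA'
    have h2 : m + 1 ≤ (m + 1) * ((Nat.log 2 (4 * m + 1) + 1) * (Nat.log 2 (2 * Δ) + 1)) :=
      Nat.le_mul_of_pos_right _ (by positivity)
    generalize Nat.log 2 (4 * m + 1) = x at *
    generalize Nat.log 2 (2 * Δ) = y at *
    have h3 : 501 * (m + 1) * (x + 1) * y ≤ 501 * ((m + 1) * ((x + 1) * (y + 1))) := by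
      rw [mul_assoc, mul_assoc]
      gcongr
      omega
    rw [show 1000 * (m + 1) * (x + 1) * (y + 1) = 1000 * ((m + 1) * ((x + 1) * (y + 1))) by ring]
    omega
  intro s1 F1 hnd _
  have a2 : s1.arr 2 = s.arr 2 := F1.2 2 (by decide)
  have hnd' : ∀ h < 2 * m, s1.arr 3 h = v h := by
    intro h hh
    rw [hnd h hh, hvdef]
    rfl
  have r1 : s1.reg 1 = m := by rw [F1.1 1 (by decide)]; simpa using hm
  have r2 : s1.reg 2 = 2 * m := by
    rw [F1.1 2 (by decide)]
    simp only [Memory.reg_setReg, if_true, Expr.eval, hm, m2]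
    exact Nat.mod_eq_of_lt (by omega)
  have r3 : s1.reg 3 = 0 := by rw [F1.1 3 (by decide)]; simpa using h3
  have r5 : s1.reg 5 = 0 := by rw [F1.1 5 (by decide)]; simpa using h5
  have hdegree : ∀ x, degree m (s1.arr 3) (s1.arr 2) x = load (2 * m) v (fun _ => 1) x := by
    intro x
    unfold degree load
    refine Finset.sum_congr rfl fun h hh => ?_
    rw [Finset.mem_range] at hh
    rw [hnd' h hh, a2, uncolored, hcol _ (by omega), if_pos rfl]
  refine WP.seq ((countDegrees_spec r2 hw).mono le_rfl ?_)
  intro s2 F2 hdeg _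
  have b2 : s2.arr 2 = s1.arr 2 := F2.2 2 (by decide)
  have b3 : s2.arr 3 = s1.arr 3 := F2.2 3 (by decide)
  have q1 : s2.reg 1 = m := (F2.1 1 (by decide)).trans r1
  have q2 : s2.reg 2 = 2 * m := (F2.1 2 (by decide)).trans r2
  have q3 : s2.reg 3 = 0 := (F2.1 3 (by decide)).trans r3
  have q5 : s2.reg 5 = 0 := (F2.1 5 (by decide)).trans r5
  refine WP.seq ((maxDegree_spec (deg := fun h => load (2 * m) v (fun _ => 1) (v h)) (Δ := Δ)
    q2 hw q3 ?_ (fun h _ => hle _) hex).mono le_rfl ?_)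
  · intro h hh
    rw [b3, hdeg h hh, hdegree, hnd' h hh]
  intro s3 F3 p3 _
  have c2 : s3.arr 2 = s1.arr 2 := (F3.2 2 (by decide)).trans b2
  have c3 : s3.arr 3 = s1.arr 3 := (F3.2 3 (by decide)).trans b3
  have p1 : s3.reg 1 = m := (F3.1 1 (by decide)).trans q1
  have p2 : s3.reg 2 = 2 * m := (F3.1 2 (by decide)).trans q2
  have p5 : s3.reg 5 = 0 := (F3.1 5 (by decide)).trans q5
  -- Only values below `2 * m` are doubled, so the power of two stays below `4 * m`, except for the
  -- initial value `1`, which the summand `1` covers when `m = 0`.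
  refine WP.seq (WP.set fun _ => WP.seq (WP.set fun _ => WP.seq ((WP.loop_frame (B := 1)
    (fun s' => ∃ t, s'.reg 6 = 2 ^ t ∧ 2 ^ t ≤ 4 * m + 1) (fun s' => 2 * m - s'.reg 6) ?_
    ⟨0, by simp [Expr.eval, m1], by simp⟩).mono ?_ ?_)))
  · rintro s' F ⟨t, ht, hle⟩ he
    have e2 : s'.reg 2 = 2 * m := by rw [F.1 2 (by decide)]; simpa using p2
    have hlt : s'.reg 6 < 2 * m := by
      by_contra hc
      simp [Expr.eval, e2, hc] at he
    have m6 : 2 * 2 ^ t % 2 ^ w = 2 * 2 ^ t := Nat.mod_eq_of_lt (by omega)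
    have hpos := Nat.two_pow_pos t
    refine WP.set ⟨⟨t + 1, ?_, ?_⟩, ?_⟩
    · simp only [Memory.reg_setReg, if_true, Expr.eval, ht, m2, m6]
      ring
    · rw [pow_succ]; omega
    · simp only [Memory.reg_setReg, if_true, Expr.eval, ht, m2, m6]
      omega
  · simp only [Memory.reg_setReg, if_true]
    omega
  rintro s4 F4 ⟨⟨t, ht, htle⟩, he⟩ _
  have o1 : s4.reg 1 = m := by rw [F4.1 1 (by decide)]; simpa using p1
  have o2 : s4.reg 2 = 2 * m := by rw [F4.1 2 (by decide)]; simpa using p2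
  have o3 : s4.reg 3 = Δ := by rw [F4.1 3 (by decide)]; simpa using p3
  have o4 : s4.reg 4 = 1 := by rw [F4.1 4 (by decide)]; simp [Expr.eval, m1]
  have o5 : s4.reg 5 = 0 := by rw [F4.1 5 (by decide)]; simpa using p5
  have d2 : s4.arr 2 = s1.arr 2 := by rw [F4.2 2 (by decide)]; simpa using c2
  have d3 : s4.arr 3 = s1.arr 3 := by rw [F4.2 3 (by decide)]; simpa using c3
  have hmT : 2 * m ≤ 2 ^ t := by
    by_contra hc
    simp only [Expr.eval, ht, o2, if_pos (not_le.1 hc), m1] at he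
    omega
  have htlog : t ≤ Nat.log 2 (4 * m + 1) := Nat.le_log_of_pow_le one_lt_two htle
  have hinit : Level m v Δ Δ 1 0 (s4.arr 3) (s4.arr 2) := by
    rw [d2, d3]
    refine (Level.initial (v := v) (Δ := Δ) (col := s1.arr 2) (m := m) ?_ fun x => ?_).congr
      (fun h hh => (hnd' h hh).symm) fun _ _ => rfl
    · rwa [a2]
    · refine le_of_eq_of_le ?_ ((hdegree x).le.trans (hle x))
      unfold degree load
      refine Finset.sum_congr rfl fun h hh => ?_
      rw [hnd' h (Finset.mem_range.1 hh)]
  -- The factor `2` inside the logarithm makes the measure drop also in the last step, from degree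
  -- `1` to `0`.
  refine (WP.loop_frame (B := A) (fun s' =>
    Level m v Δ (s'.reg 3) (s'.reg 4) (s'.reg 5) (s'.arr 3) (s'.arr 2))
    (fun s' => Nat.log 2 (2 * s'.reg 3)) ?_ (by rwa [o3, o4, o5])).mono (by rw [o3]) ?_
  · intro s' F H hD0
    simp only [Expr.eval] at hD0
    refine (levelStep_spec (n := n) ((F.1 1 (by decide)).trans o1) ((F.1 2 (by decide)).trans o2) rfl
      hD0 rfl rfl ((F.1 6 (by decide)).trans ht) hmT hw (by omega) hΔw hv hβ H).mono ?_ ?_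
    · rw [hA]
      have := Nat.mul_le_mul_left (300 * m + 301) htlog
      omega
    · rintro s'' - ⟨k3, k4, hL⟩
      refine ⟨by rwa [k3, k4], ?_⟩
      rw [k3, mul_comm 2 (s'.reg 3), Nat.log_mul_base one_lt_two hD0]
      exact Nat.lt_succ_of_le (Nat.log_mono_right (by omega))
  · rintro s' - ⟨H, he⟩
    simp only [Expr.eval] at he
    rw [he] at H
    exact ⟨_, _, _, H⟩

/-- Halted configurations persist, so after the full budget the distribution is still the point mass
at the final memory. -/
theorem WP.run_toOuterMeasure {w p B Q s} (h : WP w p B Q s) {S : Set Conf}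
    (hS : ∀ s', Q s' → (⟨[], s'⟩ : Conf) ∈ S) :
    (run w B ⟨[p], s⟩).toOuterMeasure S = 1 := by
  obtain ⟨t, s', h1, h2, h3⟩ := h
  obtain ⟨d, rfl⟩ := Nat.exists_eq_add_of_le h2
  rw [h1.run_eq, run_nil, PMF.toOuterMeasure_pure_apply, if_pos (hS s' h3)]

end WordRAM

/-! ### The graph of an edge list -/

namespace EdgeList

open WordRAM

variable {n m : ℕ} {G : SimpleGraph (Fin n)}

/-- The vertex of the half-edge `h` of an edge list. -/
def vertex (L : EdgeList G m) : ℕ → ℕ := endpoint (L.input.arr 0) (L.input.arr 1)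

theorem vertex_even (L : EdgeList G m) {i : ℕ} (hi : i < m) :
    L.vertex (2 * i) = L.src ⟨i, hi⟩ := by
  simp [vertex, endpoint, input, hi]

theorem vertex_odd (L : EdgeList G m) {i : ℕ} (hi : i < m) :
    L.vertex (2 * i + 1) = L.tgt ⟨i, hi⟩ := by
  simp [vertex, endpoint, input, show (2 * i + 1) / 2 = i by omega, hi]

theorem exists_vertex_eq (L : EdgeList G m) {h : ℕ} (hh : h < 2 * m) :
    ∃ x : Fin n, L.vertex h = x ∧ x ∈ (L.edge ⟨h / 2, by omega⟩ : Sym2 (Fin n)) := by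
  rcases Nat.even_or_odd' h with ⟨i, rfl | rfl⟩
  · exact ⟨_, L.vertex_even (by omega), by simp [edge]⟩
  · exact ⟨_, L.vertex_odd (by omega), by simp [edge, show (2 * i + 1) / 2 = i by omega]⟩

theorem exists_halfEdge_of_mem (L : EdgeList G m) (i : Fin m) {x : Fin n}
    (hx : x ∈ (L.edge i : Sym2 (Fin n))) : ∃ h < 2 * m, h / 2 = i ∧ L.vertex h = x := by
  rw [edge, Sym2.mem_iff] at hx
  rcases hx with rfl | rfl
  · exact ⟨2 * i, by omega, by omega, L.vertex_even i.2⟩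
  · exact ⟨2 * i + 1, by omega, by omega, L.vertex_odd i.2⟩

theorem halfEdgeColoring (L : EdgeList G m) (C : G.Coloring (Fin 2)) :
    ∃ β, HalfEdgeColoring m L.vertex β := by
  let γ : ℕ → Bool := fun x => if hx : x < n then decide (C ⟨x, hx⟩ = 0) else false
  refine ⟨fun h => γ (L.vertex h), fun h _ g _ e => by rw [e], fun h hh g hg e hne => ?_⟩
  have key : ∀ i < m, γ (L.vertex (2 * i)) ≠ γ (L.vertex (2 * i + 1)) := by
    intro i hi
    rw [L.vertex_even hi, L.vertex_odd hi]
    have := C.valid (L.adj ⟨i, hi⟩)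
    simp only [γ, Fin.is_lt, dite_true, Fin.eta]
    revert this
    generalize C (L.src ⟨i, hi⟩) = a
    generalize C (L.tgt ⟨i, hi⟩) = b
    revert a b
    decide
  obtain ⟨i, ⟨rfl, rfl⟩ | ⟨rfl, rfl⟩⟩ : ∃ i, h = 2 * i ∧ g = 2 * i + 1 ∨ g = 2 * i ∧ h = 2 * i + 1 :=
    ⟨h / 2, by omega⟩
  · exact key _ (by omega)
  · exact (key _ (by omega)).symm

/-- There are no loops, so each edge contributes at most one half-edge to a vertex, and the list
enumerates the edges bijectively. -/
theorem load_vertex (L : EdgeList G m) [DecidableRel G.Adj] (x : Fin n) :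
    load (2 * m) L.vertex (fun _ => 1) x = G.degree x := by
  have h1 : ∀ k, load (2 * k) L.vertex (fun _ => 1) x = ∑ i ∈ Finset.range k,
      ((if L.vertex (2 * i) = x then 1 else 0) + if L.vertex (2 * i + 1) = x then 1 else 0) := by
    intro k
    induction k with
    | zero => rfl
    | succ k ih =>
      rw [Finset.sum_range_succ, ← ih, load, show 2 * (k + 1) = 2 * k + 1 + 1 by ring,
        Finset.sum_range_succ, Finset.sum_range_succ, load, add_assoc]
  rw [h1, ← Fin.sum_univ_eq_sum_range (fun i => (if L.vertex (2 * i) = x then 1 else 0) +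
    if L.vertex (2 * i + 1) = x then 1 else 0) m, ← G.card_incidenceFinset_eq_degree x]
  have h2 : ∀ i : Fin m, ((if L.vertex (2 * i) = x then 1 else 0) +
      if L.vertex (2 * i + 1) = x then 1 else 0) =
      if x ∈ (L.edge i : Sym2 (Fin n)) then 1 else 0 := by
    intro i
    rw [L.vertex_even i.2, L.vertex_odd i.2]
    have hne := (L.adj i).ne
    simp only [Fin.eta, Fin.val_inj, edge, Sym2.mem_iff]
    by_cases e1 : L.src i = x <;> by_cases e2 : L.tgt i = x
    · exact absurd (e1.trans e2.symm) hne
    all_goals simp [e1, e2, eq_comm (a := x)]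
  rw [Finset.sum_congr rfl fun i _ => h2 i, Finset.sum_boole, Nat.cast_id]
  refine Finset.card_bij (fun i _ => (L.edge i : Sym2 (Fin n))) ?_ ?_ ?_
  · intro i hi
    rw [SimpleGraph.mem_incidenceFinset]
    exact ⟨(L.edge i).2, (Finset.mem_filter.1 hi).2⟩
  · intro i _ j _ e
    exact L.bij.1 (Subtype.ext e)
  · intro e he
    rw [SimpleGraph.mem_incidenceFinset] at he
    obtain ⟨i, hi⟩ := L.bij.2 ⟨e, he.1⟩
    have hi' : (L.edge i : Sym2 (Fin n)) = e := congrArg Subtype.val hi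
    exact ⟨i, Finset.mem_filter.2 ⟨Finset.mem_univ _, by rw [hi']; exact he.2⟩, hi'⟩

/-- At `D = 0` no edge is uncoloured, and `K * D + used = Δ` becomes `used = Δ`. -/
theorem holdsColoring (L : EdgeList G m) {Δ K used : ℕ} {nd : ℕ → ℕ} {s : Memory}
    (H : Level m L.vertex Δ 0 K used nd (s.arr 2)) : L.HoldsColoring Δ s := by
  let e := Equiv.ofBijective L.edge L.bij
  refine ⟨fun x => s.arr 2 (e.symm x), ⟨fun x => ⟨?_, ?_⟩, fun x y hxy => ?_⟩, fun i => ?_⟩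
  · exact Nat.one_le_iff_ne_zero.2 (H.ne_zero (e.symm x).2)
  · have := H.colors
    exact (H.color_le _ (e.symm x).2).trans (by omega)
  · obtain ⟨hne, z, hz1, hz2⟩ := hxy
    have ex : L.edge (e.symm x) = x := e.apply_symm_apply x
    have ey : L.edge (e.symm y) = y := e.apply_symm_apply y
    obtain ⟨h, hh, hh2, hhz⟩ := L.exists_halfEdge_of_mem (e.symm x) (x := z) (by rw [ex]; exact hz1)
    obtain ⟨g, hg, hg2, hgz⟩ := L.exists_halfEdge_of_mem (e.symm y) (x := z) (by rw [ey]; exact hz2)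
    have := H.proper h hh g hg ?_ (hhz.trans hgz.symm) ?_
    · rwa [hh2, hg2] at this
    · rw [hh2, hg2]
      exact fun h => hne (e.symm.injective (Fin.ext h))
    · exact H.ne_zero (by omega)
  · exact congrArg (fun j : Fin m => s.arr 2 j) (e.symm_apply_apply i).symm

theorem le_mul_self (L : EdgeList G m) : m ≤ n * n := by
  have : Function.Injective fun i => (L.src i, L.tgt i) := by
    intro i j h
    apply L.bij.1
    simp only [Prod.mk.injEq] at h
    simp [h.1, h.2]
  simpa using Fintype.card_le_of_injective _ this

end EdgeList

/-! ### Word size, running time and conclusion -/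

theorem theorem3p1 :
    ∃ (P : WordRAM.Prog) (a k : ℕ), ∀ c : ℕ, ∃ C : ℕ,
      ∀ (n m : ℕ) (G : SimpleGraph (Fin n)) [DecidableRel G.Adj], G.IsBipartite →
        ∀ (L : EdgeList G m) (w : ℕ), a * (Nat.log 2 n + 1) ≤ w →
          1 - ((n : ℝ≥0∞) ^ c)⁻¹ ≤
            (WordRAM.run w (C * (m + 1) * (Nat.log 2 n + 1) ^ k)
                ⟨[P], L.input⟩).toOuterMeasure
              {x | x.Halted ∧ L.HoldsColoring G.maxDegree x.mem} := by
  -- With `8 * l` bits, `2 ^ w` is at least `64 * (2 ^ l * 2 ^ l)`, enough for `4 * m + 8` and for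
  -- all node numbers. The two logarithmic factors are at most `6 * l` and `2 * l`, whence the
  -- exponent `2` and `12000 = 1000 * 6 * 2`.
  refine ⟨WordRAM.edgeColoring, 8, 2, fun c => ⟨12000, fun n m G _ hG L w hw => ?_⟩⟩
  obtain ⟨β, hβ⟩ := L.halfEdgeColoring hG.some
  set l := Nat.log 2 n + 1 with hl
  have hn : n < 2 ^ l := Nat.lt_pow_succ_log_self one_lt_two n
  have hΔ : G.maxDegree ≤ n := by
    refine G.maxDegree_le_of_forall_degree_le _ fun x => ?_
    have := G.degree_lt_card_verts x
    rw [Fintype.card_fin] at this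
    exact this.le
  have hN : 2 ≤ 2 ^ l := by rw [hl, pow_succ]; have := Nat.two_pow_pos (Nat.log 2 n); omega
  have hm : m ≤ 2 ^ l * 2 ^ l := L.le_mul_self.trans (Nat.mul_le_mul hn.le hn.le)
  have hw' : 64 * (2 ^ l * 2 ^ l) ≤ 2 ^ w := by
    calc 64 * (2 ^ l * 2 ^ l) = 2 ^ 6 * (2 ^ l * 2 ^ l) := by norm_num
      _ ≤ (2 ^ l) ^ 6 * (2 ^ l * 2 ^ l) := Nat.mul_le_mul_right _ (Nat.pow_le_pow_left hN 6)
      _ = 2 ^ (8 * l) := by rw [← pow_mul]; ring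
      _ ≤ 2 ^ w := Nat.pow_le_pow_right (by omega) hw
  have hNN : 2 * 2 ^ l ≤ 2 ^ l * 2 ^ l := Nat.mul_le_mul_right _ hN
  have hnΔ : n * G.maxDegree ≤ 2 ^ l * 2 ^ l := Nat.mul_le_mul hn.le (hΔ.trans hn.le)
  have h1 : Nat.log 2 (4 * m + 1) + 1 ≤ 6 * l := by
    have : Nat.log 2 (4 * m + 1) < 2 * l + 3 := by
      apply Nat.log_lt_of_lt_pow (by omega)
      calc 4 * m + 1 < (2 ^ l * 2 ^ l) * 2 ^ 3 := by omega
        _ = 2 ^ (2 * l + 3) := by ring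
    omega
  have h2 : Nat.log 2 (2 * G.maxDegree) + 1 ≤ 2 * l := by
    rcases Nat.eq_zero_or_pos G.maxDegree with h0 | h0
    · rw [h0, mul_zero, Nat.log_zero_right]
      omega
    · have : Nat.log 2 (2 * G.maxDegree) < l + 1 :=
        Nat.log_lt_of_lt_pow (by omega) (by rw [pow_succ]; omega)
      omega
  have hlt : ∀ h < 2 * m, L.vertex h < n := by
    intro h hh
    obtain ⟨x, hx, -⟩ := L.exists_vertex_eq hh
    rw [hx]
    exact x.2
  have hpos : ∀ x, WordRAM.load (2 * m) L.vertex (fun _ => 1) x ≠ 0 →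
      ∃ h < 2 * m, L.vertex h = x := by
    intro x hx
    obtain ⟨h, hh, hne⟩ := Finset.exists_ne_zero_of_sum_ne_zero hx
    exact ⟨h, Finset.mem_range.1 hh, by by_contra hc; simp [hc] at hne⟩
  have spec := WordRAM.edgeColoring_spec (w := w) (m := m) (n := n) (s := L.input)
    (Δ := G.maxDegree) (β := β) (v := L.vertex) (by simp [EdgeList.input])
    (by simp [EdgeList.input]) (by simp [EdgeList.input])
    (fun i _ => by simp [EdgeList.input]) rfl (by omega) (by omega) hlt hβ ?_ ?_
  -- The success probability is exactly one, so the subtracted term is simply dropped.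
  · refine tsub_le_self.trans (le_of_eq ?_)
    refine ((spec.mono ?_ fun s' _ h => h).run_toOuterMeasure ?_).symm
    · calc _ ≤ 1000 * (m + 1) * (6 * l) * (2 * l) :=
            Nat.mul_le_mul (Nat.mul_le_mul_left _ h1) h2
        _ = 12000 * (m + 1) * l ^ 2 := by ring
    · rintro s' ⟨K, used, nd, H⟩
      exact ⟨rfl, L.holdsColoring H⟩
  · intro x
    by_cases hx : WordRAM.load (2 * m) L.vertex (fun _ => 1) x = 0
    · omega
    · obtain ⟨h, hh, rfl⟩ := hpos x hx
      obtain ⟨y, hy, -⟩ := L.exists_vertex_eq hh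
      rw [hy, L.load_vertex y]
      exact G.degree_le_maxDegree y
  · by_cases h0 : G.maxDegree = 0
    · exact .inl h0
    · right
      have : Nonempty (Fin n) := by
        rw [← Fin.pos_iff_nonempty]
        omega
      obtain ⟨y, hy⟩ := G.exists_maximal_degree_vertex
      have hly := L.load_vertex y
      obtain ⟨h, hh, hv⟩ := hpos y (by omega)
      exact ⟨h, hh, by rw [hv, hly, hy]⟩
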